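/- **Conventions.** Let $k\geq 1$ and let $(M,g)$ be a Riemannian manifold of dimension $n$ and of class at least $C^k$ (that is, with a $C^k$ atlas and a metric of class $C^{k-1}$). For an open set $\Omega$ of a Euclidean space and a $C^j$ function $f$ on $\Omega$, put $\|f\|_{C^j(\Omega)}=\sum_{l=0}^{j}\sup_{\Omega}\|D^lf\|$. Given $\Gamma,\rho>0$, a *$(\Gamma,k)$-normalised chart of radius $\rho$* about $x\in M$ is a $C^k$ chart $\varphi:U\to V\subseteq\mathbb{R}^n$ of $M$ such that $x\in U$, $\varphi(x)=0$, the closed Euclidean ball of radius $\rho$ about $0$ is contained in $V$, and the matrix $G$ of $\varphi_*g$ with respect to the Euclidean metric satisfies $\|G\|_{C^{k-1}(V)}\leq\Gamma$ and $\|G^{-1}\|_{C^{k-1}(V)}\leq\Gamma$. $M$ is *$(\Gamma,k)$-normalisable over a radius $\rho$ about a set $K\subseteq M$* if every point of $K$ has such a chart about it. An immersed submanifold $\Sigma=(S,i)$ of $M$ of dimension $m$ and type $C^k$ is an $m$-dimensional $C^k$ manifold $S$ with a $C^k$ immersion $i:S\to M$; $S$ carries the metric $i^*g$, and $\Sigma$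 is *complete* if $(S,i^*g)$ is. For $k\geq 2$ let $A_2$ be the second fundamental form of $\Sigma$ and, for $3\leq j\leq k$, let $A_j=\nabla A_{j-1}$, where $\nabla$ is the covariant derivative induced by the Levi-Civita connections of $i^*g$ (on $TS$) and $g$ (on $i^*TM$); put $\mathcal{A}_k=\sum_{j=2}^k\|A_j\|$, with pointwise norms taken with respect to $i^*g$ and $g$. All balls below, unless called closed, are open; $B^m_r(0)$ is the Euclidean ball in $\mathbb{R}^m$, and $B_\rho(p)$ is the ball in $S$ for the distance of $i^*g$. **Lemma.** Let $k\geq 2$ and $1\leq m\leq n$ be integers and let $\Gamma,B,\rho>0$. There exist $C,r>0$, depending only on $k,m,n,\Gamma,B,\rho$, with the following property. Let $(M,g)$ be a complete Riemannian manifold of dimension $n$ and of class at least $C^k$, let $K\subseteq M$ be a subset about which $M$ is $(\Gamma,k)$-normalisable over a radius $\rho$, let $\Sigma=(S,i)$ be a complete immersed submanifold of $M$ of dimension $m$ and of type $C^k$, and let $p\in S$ be such that $i(p)\in K$ and $\mathcal{A}_k(q)\leq B$ for all $q\in B_\rho(p)$. Then for every $(\Gamma,k)$-normalised chart $\varphi:U\to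 V$ of $M$ of radius $\rho$ about $i(p)$ there exist a $C^k$ function $f:B^m_r(0)\to\mathbb{R}^{n-m}$ with $f(0)=0$ and $df(0)=0$, an open neighbourhood $\Omega$ of $p$ in $S$, a $C^k$ diffeomorphism $\alpha:B^m_r(0)\to\Omega$ with $\alpha(0)=p$, and a rotation $A\in SO(n)$, such that 1. for all $x\in B^m_r(0)$, $i(\alpha(x))\in U$ and $\varphi(i(\alpha(x)))=A\,(x,f(x))$, and 2. $\|f\|_{C^k(B^m_r(0))}\leq C$. -/

import Mathlib

open scoped Manifold ContDiff ENNReal Topology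
open Bundle Set

noncomputable section

namespace SubmanifoldGraph

/-- `ℝ^d` with its Euclidean norm. -/
abbrev Euc (d : ℕ) : Type := EuclideanSpace ℝ (Fin d)

/-- The `C^k` norm `∑_{j ≤ k} sup_Ω ‖D^j f‖` of a `C^k` function on an open set `Ω`, as an element
of `[0, ∞]`. -/
def ckNorm {E F : Type*} [NormedAddCommGroup E] [NormedSpace ℝ E]
    [NormedAddCommGroup F] [NormedSpace ℝ F] (k : ℕ) (f : E → F) (Ω : Set E) : ℝ≥0∞ :=
  ∑ j ∈ Finset.range (k + 1), ⨆ x ∈ Ω, ‖iteratedFDeriv ℝ j f x‖ₑ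

/-- The matrix `g_{ab}(y)` of a Riemannian metric in the chart `φ`, at the point `y` of the image of
`φ`: the inner products of the coordinate vector fields of `φ`. -/
def metricMatrix {d : ℕ} {X : Type*} [TopologicalSpace X] [ChartedSpace (Euc d) X]
    [RiemannianBundle (fun x : X => TangentSpace (𝓡 d) x)]
    (φ : OpenPartialHomeomorph X (Euc d)) (y : Euc d) : Matrix (Fin d) (Fin d) ℝ :=
  Matrix.of fun a b =>
    inner ℝ (mfderiv (𝓡 d) (𝓡 d) φ.symm y (EuclideanSpace.single a (1 : ℝ) : Euc d))
      (mfderiv (𝓡 d) (𝓡 d) φ.symm y (EuclideanSpace.single b (1 : ℝ) : Euc d))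

/-- `φ : U → V` (with `U = φ.source`, `V = φ.target`) is a `(Γ, k)`-normalised chart of radius `ρ`
about `p`. Matrices are viewed as operators of Euclidean space and carry the operator norm. -/
structure IsNormalisedChart {n : ℕ} {M : Type*} [TopologicalSpace M] [ChartedSpace (Euc n) M]
    [RiemannianBundle (fun x : M => TangentSpace (𝓡 n) x)]
    (Γ : ℝ) (k : ℕ) (ρ : ℝ) (p : M) (φ : OpenPartialHomeomorph M (Euc n)) : Prop where
  mem_atlas : φ ∈ IsManifold.maximalAtlas (𝓡 n) (k : WithTop ℕ∞) M
  mem_source : p ∈ φ.source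
  map_center : φ p = 0
  ball_subset : Metric.closedBall (0 : Euc n) ρ ⊆ φ.target
  metric_le : ckNorm (k - 1) (fun y => Matrix.toEuclideanCLM (𝕜 := ℝ) (metricMatrix φ y)) φ.target
    ≤ ENNReal.ofReal Γ
  inv_metric_le :
    ckNorm (k - 1) (fun y => Matrix.toEuclideanCLM (𝕜 := ℝ) (metricMatrix φ y)⁻¹) φ.target
      ≤ ENNReal.ofReal Γ

/-- `M` is `(Γ, k)`-normalisable over a radius `ρ` about the set `K`. -/
def IsNormalisableAbout {n : ℕ} {M : Type*} [TopologicalSpace M] [ChartedSpace (Euc n) M]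
    [RiemannianBundle (fun x : M => TangentSpace (𝓡 n) x)]
    (Γ : ℝ) (k : ℕ) (ρ : ℝ) (K : Set M) : Prop :=
  ∀ p ∈ K, ∃ φ : OpenPartialHomeomorph M (Euc n), IsNormalisedChart Γ k ρ p φ

/-- `i : S → M` is a `C^k` immersion and the Riemannian metric of `S` is the induced metric
`i^* g`. (Injectivity of the differential follows from the second condition.) -/
structure IsIsometricImmersion {m n : ℕ} {S M : Type*}
    [TopologicalSpace S] [ChartedSpace (Euc m) S]
    [RiemannianBundle (fun x : S => TangentSpace (𝓡 m) x)]
    [TopologicalSpace M] [ChartedSpace (Euc n) M]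
    [RiemannianBundle (fun x : M => TangentSpace (𝓡 n) x)]
    (k : ℕ) (i : S → M) : Prop where
  contMDiff : ContMDiff (𝓡 m) (𝓡 n) (k : WithTop ℕ∞) i
  inner_map : ∀ (q : S) (v w : TangentSpace (𝓡 m) q),
    inner ℝ (mfderiv (𝓡 m) (𝓡 n) i q v) (mfderiv (𝓡 m) (𝓡 n) i q w) = inner ℝ v w

/-! ### The second fundamental form and its covariant derivatives, in coordinates -/

/-- The partial derivative `∂_a f`. -/
def pd {d : ℕ} (a : Fin d) (f : Euc d → ℝ) (x : Euc d) : ℝ :=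
  fderiv ℝ f x (EuclideanSpace.single a (1 : ℝ))

/-- The Christoffel symbol `Γ^c_{ab}` of the metric with matrix `G`. -/
def christoffel {d : ℕ} (G : Euc d → Matrix (Fin d) (Fin d) ℝ) (c a b : Fin d) (x : Euc d) : ℝ :=
  (1 / 2) * ∑ e, (G x)⁻¹ c e *
    (pd a (fun y => G y b e) x + pd b (fun y => G y a e) x - pd e (fun y => G y a b) x)

/-- Components `T^γ_{a_1 … a_j}` of a field of `j`-linear forms on the tangent spaces of the
submanifold with values in the tangent spaces of the ambient manifold, in coordinates of both. -/
abbrev Components (m n j : ℕ) : Type := Euc m → (Fin j → Fin m) → Fin n → ℝ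

/-- The second fundamental form `II(∂_a, ∂_b) = ∇_{∂_a} ∂_b - ∇'_{∂_a} ∂_b` of the map `F` from a
coordinate domain with metric `h = F^* G` to one with metric `G`, where `∇` and `∇'` are the
Levi-Civita connections of `G` and `h` (Gauss formula). -/
def secondForm {m n : ℕ} (h : Euc m → Matrix (Fin m) (Fin m) ℝ)
    (G : Euc n → Matrix (Fin n) (Fin n) ℝ) (F : Euc m → Euc n) : Components m n 2 :=
  fun x I γ =>
    pd (I 0) (pd (I 1) (fun y => F y γ)) x
      + ∑ α, ∑ β, christoffel G γ α β (F x)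
          * pd (I 0) (fun y => F y α) x * pd (I 1) (fun y => F y β) x
      - ∑ c, christoffel h c (I 0) (I 1) x * pd c (fun y => F y γ) x

/-- The covariant derivative of a field as in `Components`: the values, which are tangent vectors of
the ambient manifold along `F`, are differentiated with the pull-back of the Levi-Civita connection
of `G`, and the arguments with the Levi-Civita connection of `h`. The direction of
differentiation is the first argument of the result. -/
def covDeriv {m n : ℕ} (h : Euc m → Matrix (Fin m) (Fin m) ℝ)
    (G : Euc n → Matrix (Fin n) (Fin n) ℝ) (F : Euc m → Euc n) {j : ℕ}
    (T : Components m n j) : Components m n (j + 1) :=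
  fun x I γ =>
    pd (I 0) (fun y => T y (Fin.tail I) γ) x
      + ∑ α, ∑ β, christoffel G γ α β (F x)
          * pd (I 0) (fun y => F y α) x * T x (Fin.tail I) β
      - ∑ l : Fin j, ∑ c, christoffel h c (I 0) (Fin.tail I l) x
          * T x (Function.update (Fin.tail I) l c) γ

/-- `higherForm h G F j` is `A_{j+2} = ∇^j II`. -/
def higherForm {m n : ℕ} (h : Euc m → Matrix (Fin m) (Fin m) ℝ)
    (G : Euc n → Matrix (Fin n) (Fin n) ℝ) (F : Euc m → Euc n) : (j : ℕ) → Components m n (j + 2)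
  | 0 => secondForm h G F
  | j + 1 => covDeriv h G F (higherForm h G F j)

/-- The norm of a `j`-linear map with components `T`, from a space with inner product `h` to a space
with inner product `G`: the supremum of `|T(v_1, …, v_j)|_G` over all `v_l` with
`|v_l|_h ≤ 1`. -/
def tensorNorm {m n j : ℕ} (h : Matrix (Fin m) (Fin m) ℝ) (G : Matrix (Fin n) (Fin n) ℝ)
    (T : (Fin j → Fin m) → Fin n → ℝ) : ℝ≥0∞ :=
  ⨆ v ∈ {v : Fin j → Fin m → ℝ | ∀ l, ∑ a, ∑ b, h a b * v l a * v l b ≤ 1},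
    ENNReal.ofReal (√(∑ γ, ∑ δ, G γ δ
      * (∑ I : Fin j → Fin m, (∏ l, v l (I l)) * T I γ)
      * (∑ I : Fin j → Fin m, (∏ l, v l (I l)) * T I δ)))

section

variable {m n : ℕ} {S M : Type*} [TopologicalSpace S] [ChartedSpace (Euc m) S]
  [RiemannianBundle (fun x : S => TangentSpace (𝓡 m) x)]
  [TopologicalSpace M] [ChartedSpace (Euc n) M]
  [RiemannianBundle (fun x : M => TangentSpace (𝓡 n) x)]

/-- `∑_{j=2}^k ‖A_j(q)‖`, computed in a chart `ψ` of the submanifold about `q` and a chart `φ` of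
the ambient manifold about `i q`. -/
def formBoundInCharts (k : ℕ) (i : S → M) (q : S)
    (ψ : OpenPartialHomeomorph S (Euc m)) (φ : OpenPartialHomeomorph M (Euc n)) : ℝ≥0∞ :=
  ∑ j ∈ Finset.range (k - 1),
    tensorNorm (metricMatrix ψ (ψ q)) (metricMatrix φ (φ (i q)))
      (higherForm (metricMatrix ψ) (metricMatrix φ) (φ ∘ i ∘ ψ.symm) j (ψ q))

/-- `𝒜_k(q) = ∑_{j=2}^k ‖A_j(q)‖`, where `A_2` is the second fundamental form of the isometric
immersion `i` and `A_{j+1} = ∇ A_j`. The right-hand side is the common value of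
`formBoundInCharts` in all `C^k` charts about `q` and `i q`: the `A_j` are tensors, so that
this number does not depend on the charts. -/
def formBound (k : ℕ) (i : S → M) (q : S) : ℝ≥0∞ :=
  ⨆ (ψ ∈ {ψ ∈ IsManifold.maximalAtlas (𝓡 m) (k : WithTop ℕ∞) S | q ∈ ψ.source})
    (φ ∈ {φ ∈ IsManifold.maximalAtlas (𝓡 n) (k : WithTop ℕ∞) M | i q ∈ φ.source}),
    formBoundInCharts k i q ψ φ

end

/-- The point `(x, z)` of `ℝ^n = ℝ^m ⊕ ℝ^{n-m}`. -/
def joinCoords {m n : ℕ} (x : Euc m) (z : Euc (n - m)) : Euc n :=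
  WithLp.toLp 2 fun a : Fin n =>
    if h : (a : ℕ) < m then x ⟨a, h⟩ else z ⟨(a : ℕ) - m, by omega⟩

end SubmanifoldGraph

end

open SubmanifoldGraph

noncomputable section

namespace SubmanifoldGraph

/-! Rotate the chart `φ` so that the tangent space of the submanifold at `p` becomes `ℝ^m × 0`, and
let `P`, `Q` be the projections to the first `m` and the last `n - m` rotated coordinates. Where the
image has slope less than `1`, the map `P ∘ φ ∘ i` is a local diffeomorphism. A section of it over a
ball about `0` parametrises the submanifold by a graph `F`, with `P ∘ F = id` and `‖DF‖ ≤ 2`.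

Derivative estimate (`jetBounded_pd_of_higherForm`, `GraphGerm.exists_norm_iteratedFDeriv_le`). The
Gauss formula writes `∂∂F` in terms of the second fundamental form, the ambient Christoffel symbols,
`∂F`, and the Christoffel symbols of the induced metric. The last ones seem to cost second
derivatives of `F`; but `P ∘ F = id` gives `P (∂∂F) = 0`, so the `P`-part of the formula expresses
them through the other terms (`christoffel_eq_of_graph`). Thus `∂∂F` is a polynomial in bounded
quantities. Differentiating, and trading a derivative of `A_j` for `A_{j+1}` plus terms already
controlled, bounds all derivatives of orders `2` to `k` by a constant `C₀` of the data.

Continuation (`LocallyHomeoOn.exists_section_ball`, `IsGraphChart.exists_tendsto`). The bound on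
`D²F` keeps the slope at most `1 / 2` on balls of radius at most `r`, where `C₀ r ≤ 1 / 2`: better
than the `1` that was assumed. For small `r` the graph also stays in the chart and in `B_ρ(p)`,
where the curvature bound holds. Sections are Lipschitz and `S` is complete, so a section has limits
at the boundary of its ball; by the improved slope these are again points where the image is a
graph. Hence the section extends, and no radius below `r` is maximal. Finally `f = Q ∘ F`. -/

/-! ### Families of functions whose jets are uniformly bounded -/

/-- The functions `u i` are `C^s` at the points `x i`, with derivatives up to order `s` there bounded
uniformly in `i`. -/
def JetBounded {ι E F : Type*} [NormedAddCommGroup E] [NormedSpace ℝ E]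
    [NormedAddCommGroup F] [NormedSpace ℝ F] (x : ι → E) (s : ℕ) (u : ι → E → F) : Prop :=
  (∀ i, ContDiffAt ℝ s (u i) (x i)) ∧
    ∃ D : ℝ, ∀ i, ∀ j ≤ s, ‖iteratedFDeriv ℝ j (u i) (x i)‖ ≤ D

namespace JetBounded

section General

variable {ι E F F' : Type*} [NormedAddCommGroup E] [NormedSpace ℝ E]
  [NormedAddCommGroup F] [NormedSpace ℝ F] [NormedAddCommGroup F'] [NormedSpace ℝ F']
  {x : ι → E} {s t : ℕ} {u v : ι → E → F}

lemma mono (h : JetBounded x s u) (hts : t ≤ s) : JetBounded x t u := by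
  obtain ⟨h1, D, hD⟩ := h
  exact ⟨fun i => (h1 i).of_le (by exact_mod_cast hts), D, fun i j hj => hD i j (hj.trans hts)⟩

lemma congr (h : JetBounded x s u) (huv : ∀ i, v i =ᶠ[𝓝 (x i)] u i) : JetBounded x s v := by
  obtain ⟨h1, D, hD⟩ := h
  refine ⟨fun i => (h1 i).congr_of_eventuallyEq (huv i), D, fun i j hj => ?_⟩
  rw [((huv i).iteratedFDeriv ℝ j).eq_of_nhds]
  exact hD i j hj

lemma zero_iff : JetBounded x 0 u ↔
    (∀ i, ContDiffAt ℝ 0 (u i) (x i)) ∧ ∃ D : ℝ, ∀ i, ‖u i (x i)‖ ≤ D := by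
  simp [JetBounded]

lemma value_le (h : JetBounded x s u) : ∃ D : ℝ, ∀ i, ‖u i (x i)‖ ≤ D := by
  obtain ⟨h1, D, hD⟩ := h
  exact ⟨D, fun i => by simpa using hD i 0 (Nat.zero_le _)⟩

lemma add (hu : JetBounded x s u) (hv : JetBounded x s v) :
    JetBounded x s (fun i y => u i y + v i y) := by
  obtain ⟨h1, D, hD⟩ := hu
  obtain ⟨h2, D', hD'⟩ := hv
  refine ⟨fun i => (h1 i).add (h2 i), D + D', fun i j hj => ?_⟩
  have : iteratedFDeriv ℝ j (fun y => u i y + v i y) (x i)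
      = iteratedFDeriv ℝ j (u i) (x i) + iteratedFDeriv ℝ j (v i) (x i) :=
    iteratedFDeriv_add_apply ((h1 i).of_le (by exact_mod_cast hj))
      ((h2 i).of_le (by exact_mod_cast hj))
  rw [this]
  exact (norm_add_le _ _).trans (add_le_add (hD i j hj) (hD' i j hj))

lemma const {c : ι → F} {D : ℝ} (hc : ∀ i, ‖c i‖ ≤ D) : JetBounded x s (fun i _ => c i) := by
  refine ⟨fun i => contDiffAt_const, max D 0, fun i j _ => ?_⟩
  rcases Nat.eq_zero_or_pos j with rfl | hj
  · simpa using Or.inl (hc i)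
  · simp [iteratedFDeriv_const_of_ne hj.ne']

lemma zero : JetBounded x s (fun _ _ => (0 : F)) :=
  const (D := 0) (fun i => by simp)

lemma sum {κ : Type*} {J : Finset κ} {w : κ → ι → E → F} (h : ∀ a ∈ J, JetBounded x s (w a)) :
    JetBounded x s (fun i y => ∑ a ∈ J, w a i y) := by
  classical
  induction J using Finset.induction_on with
  | empty => simpa using zero
  | insert a J ha ih =>
    simp only [Finset.sum_insert ha]
    exact (h a (Finset.mem_insert_self _ _)).add
      (ih fun b hb => h b (Finset.mem_insert_of_mem hb))

lemma clm {L : ι → F →L[ℝ] F'} {D : ℝ} (hL : ∀ i, ‖L i‖ ≤ D) (hu : JetBounded x s u) :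
    JetBounded x s (fun i y => L i (u i y)) := by
  obtain ⟨h1, D', hD'⟩ := hu
  refine ⟨fun i => (L i).contDiff.contDiffAt.comp _ (h1 i), D * D', fun i j hj => ?_⟩
  have := (L i).norm_iteratedFDeriv_comp_left (h1 i) (n := j) (by exact_mod_cast hj)
  refine this.trans ?_
  exact mul_le_mul (hL i) (hD' i j hj) (norm_nonneg _) ((norm_nonneg _).trans (hL i))

lemma neg (hu : JetBounded x s u) : JetBounded x s (fun i y => -u i y) := by
  have := hu.clm (L := fun _ => -ContinuousLinearMap.id ℝ F) (D := ‖-ContinuousLinearMap.id ℝ F‖)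
    (fun _ => le_rfl)
  simpa using this

lemma sub (hu : JetBounded x s u) (hv : JetBounded x s v) :
    JetBounded x s (fun i y => u i y - v i y) := by
  simpa [sub_eq_add_neg] using hu.add hv.neg

lemma fderiv (hu : JetBounded x (s + 1) u) : JetBounded x s (fun i => fderiv ℝ (u i)) := by
  obtain ⟨h1, D, hD⟩ := hu
  refine ⟨fun i => (h1 i).fderiv_right (by norm_cast), D, fun i j hj => ?_⟩
  rw [norm_iteratedFDeriv_fderiv]
  exact hD i (j + 1) (by omega)

lemma succ_of_fderiv (h0 : ∃ D : ℝ, ∀ i, ‖u i (x i)‖ ≤ D)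
    (h1 : ∀ i, ContDiffAt ℝ (s + 1 : ℕ) (u i) (x i))
    (h2 : JetBounded x s (fun i => _root_.fderiv ℝ (u i))) : JetBounded x (s + 1) u := by
  obtain ⟨D, hD⟩ := h0
  obtain ⟨-, D', hD'⟩ := h2
  refine ⟨h1, max D D', fun i j hj => ?_⟩
  rcases j with _ | j
  · simpa using Or.inl (hD i)
  · rw [← norm_iteratedFDeriv_fderiv]
    exact (hD' i j (by omega)).trans (le_max_right _ _)

end General

section Coordinates

variable {ι : Type*} {d : ℕ} {x : ι → Euc d} {s t : ℕ} {u v : ι → Euc d → ℝ}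

lemma pd (a : Fin d) (hu : JetBounded x (s + 1) u) : JetBounded x s (fun i => pd a (u i)) := by
  have := hu.fderiv.clm
    (L := fun _ => ContinuousLinearMap.apply ℝ ℝ (EuclideanSpace.single a (1 : ℝ) : Euc d))
    (fun _ => le_rfl)
  exact this

end Coordinates
end JetBounded

/-! ### Calculus with partial derivatives -/

lemma fderiv_eq_sum_pd {d : ℕ} (f : Euc d → ℝ) (x v : Euc d) :
    fderiv ℝ f x v = ∑ a, v a * pd a f x := by
  have hv : v = ∑ a, v a • (EuclideanSpace.single a (1 : ℝ) : Euc d) := by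
    ext b
    simp [Finset.sum_apply, Pi.single_apply]
  conv_lhs => rw [hv]
  simp [pd]

lemma _root_.ContDiffAt.pd {d : ℕ} {f : Euc d → ℝ} {x : Euc d} {s t : ℕ} (a : Fin d)
    (h : ContDiffAt ℝ s f x) (hst : t + 1 ≤ s) : ContDiffAt ℝ t (pd a f) x := by
  have h1 : ContDiffAt ℝ t (fderiv ℝ f) x := h.fderiv_right (by exact_mod_cast hst)
  exact h1.clm_apply contDiffAt_const

lemma _root_.ContDiffAt.eventually_differentiableAt {E F : Type*} [NormedAddCommGroup E]
    [NormedSpace ℝ E] [NormedAddCommGroup F] [NormedSpace ℝ F] {f : E → F} {x : E} {s : ℕ}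
    (h : ContDiffAt ℝ s f x) (hs : 1 ≤ s) : ∀ᶠ y in 𝓝 x, DifferentiableAt ℝ f y := by
  have h1 : ContDiffAt ℝ 1 f x := h.of_le (by exact_mod_cast hs)
  filter_upwards [h1.eventually (by simp)] with y hy
  exact hy.differentiableAt (by simp)

lemma pd_mul {d : ℕ} {f g : Euc d → ℝ} {x : Euc d} (hf : DifferentiableAt ℝ f x)
    (hg : DifferentiableAt ℝ g x) (a : Fin d) :
    pd a (fun y => f y * g y) x = pd a f x * g x + f x * pd a g x := by
  simp only [pd, fderiv_fun_mul hf hg]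
  simp; ring

lemma pd_comp {m n : ℕ} {f : Euc n → ℝ} {F : Euc m → Euc n} {x : Euc m}
    (hf : DifferentiableAt ℝ f (F x)) (hF : DifferentiableAt ℝ F x) (a : Fin m) :
    pd a (fun y => f (F y)) x = ∑ γ, pd γ f (F x) * pd a (fun y => F y γ) x := by
  have h1 : fderiv ℝ (fun y => f (F y)) x = (fderiv ℝ f (F x)).comp (fderiv ℝ F x) :=
    fderiv_comp x hf hF
  have h2 : ∀ γ, pd a (fun y => F y γ) x = fderiv ℝ F x (EuclideanSpace.single a 1) γ := by
    intro γ
    have := (EuclideanSpace.proj γ : Euc n →L[ℝ] ℝ).hasFDerivAt.comp x hF.hasFDerivAt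
    have h3 : fderiv ℝ (fun y => F y γ) x
      = (EuclideanSpace.proj γ : Euc n →L[ℝ] ℝ).comp (fderiv ℝ F x) := this.fderiv
    simp [pd, h3]
  rw [pd, h1, ContinuousLinearMap.comp_apply, fderiv_eq_sum_pd]
  simp only [h2]
  exact Finset.sum_congr rfl fun _ _ => mul_comm _ _

namespace JetBounded

variable {ι : Type*} {d m n : ℕ} {x : ι → Euc d} {s t : ℕ} {u v : ι → Euc d → ℝ}

/-- This is the inductive step of every later estimate: one order is gained from the partial
derivatives, so that only first-order product and chain rules are needed, never their higher-order
versions. -/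
lemma succ_of_pd (h0 : ∃ D : ℝ, ∀ i, ‖u i (x i)‖ ≤ D)
    (h1 : ∀ i, ContDiffAt ℝ (s + 1 : ℕ) (u i) (x i))
    (h2 : ∀ a, JetBounded x s (fun i => SubmanifoldGraph.pd a (u i))) : JetBounded x (s + 1) u := by
  refine succ_of_fderiv h0 h1 ?_
  have h3 : JetBounded x s (fun i y => ∑ a : Fin d,
      (ContinuousLinearMap.toSpanSingleton ℝ (EuclideanSpace.proj a : Euc d →L[ℝ] ℝ))
        (SubmanifoldGraph.pd a (u i) y)) :=
    sum fun a _ => (h2 a).clm (fun _ => le_rfl)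
  convert h3 using 3 with i y
  ext v
  rw [fderiv_eq_sum_pd]
  simp [mul_comm]

lemma mul (hu : JetBounded x s u) (hv : JetBounded x s v) :
    JetBounded x s (fun i y => u i y * v i y) := by
  induction s generalizing u v with
  | zero =>
    rw [zero_iff] at *
    obtain ⟨hu1, D, hD⟩ := hu
    obtain ⟨hv1, D', hD'⟩ := hv
    refine ⟨fun i => (hu1 i).mul (hv1 i), D * D', fun i => ?_⟩
    rw [norm_mul]
    exact mul_le_mul (hD i) (hD' i) (norm_nonneg _) ((norm_nonneg _).trans (hD i))
  | succ s ih =>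
    refine succ_of_pd ?_ (fun i => (hu.1 i).mul (hv.1 i)) fun a => ?_
    · obtain ⟨D, hD⟩ := hu.value_le
      obtain ⟨D', hD'⟩ := hv.value_le
      refine ⟨D * D', fun i => ?_⟩
      rw [norm_mul]
      exact mul_le_mul (hD i) (hD' i) (norm_nonneg _) ((norm_nonneg _).trans (hD i))
    · refine ((ih (hu.pd a) (hv.mono s.le_succ)).add (ih (hu.mono s.le_succ) (hv.pd a))).congr ?_
      intro i
      filter_upwards [(hu.1 i).eventually_differentiableAt (by omega),
        (hv.1 i).eventually_differentiableAt (by omega)] with y h1 h2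
      exact pd_mul h1 h2 a

/-- The values of `F i` need no bound, since only `u i` is evaluated there. Partial derivatives of
`F i` are needed only to order `s - 1`; this gap of one is what lets the bootstrap below advance. -/
lemma comp {x : ι → Euc m} {F : ι → Euc m → Euc n} {u : ι → Euc n → ℝ}
    (hu : JetBounded (fun i => F i (x i)) s u) (hF : ∀ i, ContDiffAt ℝ s (F i) (x i))
    (hF' : ∀ t, t + 1 ≤ s → ∀ a γ, JetBounded x t (fun i => SubmanifoldGraph.pd a (fun y => F i y γ))) :
    JetBounded x s (fun i y => u i (F i y)) := by
  induction s generalizing u with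
  | zero =>
    rw [zero_iff] at *
    exact ⟨fun i => (hu.1 i).comp _ (hF i), hu.2⟩
  | succ s ih =>
    refine succ_of_pd hu.value_le (fun i => (hu.1 i).comp _ (hF i)) fun a => ?_
    have h1 : JetBounded x s (fun i y => ∑ γ, SubmanifoldGraph.pd γ (u i) (F i y)
        * SubmanifoldGraph.pd a (fun y => F i y γ) y) := by
      refine sum fun γ _ => mul (ih (hu.pd γ)
        (fun i => (hF i).of_le (by norm_cast; omega)) fun t ht => hF' t (by omega)) (hF' s le_rfl a γ)
    refine h1.congr fun i => ?_
    filter_upwards [(hF i).eventually_differentiableAt (by omega),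
      (hF i).continuousAt.eventually ((hu.1 i).eventually_differentiableAt (by omega))] with y h1 h2
    exact pd_comp h2 h1 a

end JetBounded

/-! ### Derivative estimates for submanifolds in graph coordinates -/

/-- Differentiability of finite order at a point spreads to a neighbourhood; order `∞` has to be
excluded. -/
lemma natCast_ne_infty (N : ℕ) : (N : WithTop ℕ∞) ≠ ((⊤ : ℕ∞) : WithTop ℕ∞) := by
  have : ((N : ℕ∞) : WithTop ℕ∞) ≠ ((⊤ : ℕ∞) : WithTop ℕ∞) := by
    rw [Ne, WithTop.coe_inj]
    exact ENat.natCast_ne_top N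
  exact this

section Algebra

variable {m n : ℕ}

lemma contDiffAt_component {E : Type*} [NormedAddCommGroup E] [NormedSpace ℝ E] {F : E → Euc n}
    {x : E} {s : WithTop ℕ∞} (hF : ContDiffAt ℝ s F x) (γ : Fin n) :
    ContDiffAt ℝ s (fun y => F y γ) x :=
  (EuclideanSpace.proj γ : Euc n →L[ℝ] ℝ).contDiff.contDiffAt.comp x hF

lemma pd_congr {f g : Euc m → ℝ} {x : Euc m} (h : f =ᶠ[𝓝 x] g) (a : Fin m) :
    pd a f x = pd a g x := by
  simp only [pd, h.fderiv_eq]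

lemma pd_linearCombination {κ : Type*} [Fintype κ] {f : κ → Euc m → ℝ} {x : Euc m}
    (c : κ → ℝ) (hf : ∀ γ, DifferentiableAt ℝ (f γ) x) (a : Fin m) :
    pd a (fun y => ∑ γ, c γ * f γ y) x = ∑ γ, c γ * pd a (f γ) x := by
  have h : HasFDerivAt (fun y => ∑ γ, c γ * f γ y) (∑ γ, c γ • fderiv ℝ (f γ) x) x :=
    HasFDerivAt.fun_sum fun γ _ => (hf γ).hasFDerivAt.const_mul (c γ)
  simp [pd, h.fderiv]

lemma pd_coord (a c : Fin m) (x : Euc m) :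
    pd a (fun y : Euc m => y c) x = if a = c then 1 else 0 := by
  have h : fderiv ℝ (fun y : Euc m => y c) x = (EuclideanSpace.proj c : Euc m →L[ℝ] ℝ) :=
    (EuclideanSpace.proj c : Euc m →L[ℝ] ℝ).hasFDerivAt.fderiv
  simp [pd, h, eq_comm]

lemma pd_const (a : Fin m) (c : ℝ) (x : Euc m) : pd a (fun _ : Euc m => c) x = 0 := by
  simp [pd]

variable {h : Euc m → Matrix (Fin m) (Fin m) ℝ} {G : Euc n → Matrix (Fin n) (Fin n) ℝ}
  {F : Euc m → Euc n} {x : Euc m} {N : ℕ}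

/-- Count of derivatives: `∇^j II` consumes `j + 2` derivatives of `F` and `j` of the Christoffel
symbols, which leaves `t` of them as long as `j + t ≤ N`. -/
lemma contDiffAt_higherForm (hF : ContDiffAt ℝ (N + 2 : ℕ) F x)
    (hG : ∀ γ α β, ContDiffAt ℝ N (christoffel G γ α β) (F x))
    (hh : ∀ c a b, ContDiffAt ℝ N (christoffel h c a b) x) (j t : ℕ) (hjt : j + t ≤ N)
    (I : Fin (j + 2) → Fin m) (γ : Fin n) :
    ContDiffAt ℝ t (fun y => higherForm h G F j y I γ) x := by
  have hF1 : ∀ {t' : ℕ}, t' ≤ N + 1 → ∀ (a : Fin m) (γ : Fin n),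
      ContDiffAt ℝ t' (pd a (fun y => F y γ)) x :=
    fun ht a γ => (contDiffAt_component hF γ).pd a (by omega)
  have hGF : ∀ {t' : ℕ}, t' ≤ N → ∀ γ α β,
      ContDiffAt ℝ t' (fun y => christoffel G γ α β (F y)) x := fun ht γ α β =>
    ((hG γ α β).of_le (by exact_mod_cast ht)).comp x (hF.of_le (by exact_mod_cast (by omega)))
  have hh' : ∀ {t' : ℕ}, t' ≤ N → ∀ c a b, ContDiffAt ℝ t' (christoffel h c a b) x :=
    fun ht c a b => (hh c a b).of_le (by exact_mod_cast ht)
  induction j generalizing t γ with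
  | zero =>
    simp only [higherForm, secondForm]
    refine ContDiffAt.sub (ContDiffAt.add ?_ ?_) ?_
    · exact (hF1 (t' := t + 1) (by omega) _ _).pd _ le_rfl
    · exact ContDiffAt.sum fun α _ => ContDiffAt.sum fun β _ =>
        ((hGF (by omega) _ _ _).mul (hF1 (by omega) _ _)).mul (hF1 (by omega) _ _)
    · exact ContDiffAt.sum fun c _ => (hh' (by omega) _ _ _).mul (hF1 (by omega) _ _)
  | succ j ih =>
    simp only [higherForm, covDeriv]
    refine ContDiffAt.sub (ContDiffAt.add ?_ ?_) ?_
    · exact (ih (t + 1) (by omega) _ _).pd _ le_rfl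
    · exact ContDiffAt.sum fun α _ => ContDiffAt.sum fun β _ =>
        ((hGF (by omega) _ _ _).mul (hF1 (by omega) _ _)).mul (ih t (by omega) _ _)
    · exact ContDiffAt.sum fun l _ => ContDiffAt.sum fun c _ =>
        (hh' (by omega) _ _ _).mul (ih t (by omega) _ _)

/-- If `F` is a graph over its tangential coordinates `ℓ`, then the Christoffel symbols of the
submanifold are the tangential components of the normal equation. -/
lemma christoffel_eq_of_graph (hF : ContDiffAt ℝ (2 : ℕ) F x) {ℓ : Fin m → Fin n → ℝ}
    (hℓ : ∀ᶠ y in 𝓝 x, ∀ c, ∑ γ, ℓ c γ * F y γ = y c) (c a b : Fin m) :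
    christoffel h c a b x = ∑ γ, ℓ c γ * ((∑ α, ∑ β, christoffel G γ α β (F x)
      * pd a (fun y => F y α) x * pd b (fun y => F y β) x) - secondForm h G F x ![a, b] γ) := by
  -- Differentiating `ℓ (F y) = y` once gives the identity matrix, and twice gives zero (`h2`).
  -- Contracting the Gauss formula with `ℓ c` therefore removes `∂∂F` and isolates one Christoffel
  -- symbol of `h`.
  have h1 : ∀ (c b : Fin m), ∀ᶠ y in 𝓝 x,
      ∑ γ, ℓ c γ * pd b (fun y => F y γ) y = if b = c then 1 else 0 := by
    intro c b
    filter_upwards [hℓ.eventually_nhds, hF.eventually_differentiableAt (by omega)] with y hy hd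
    rw [← pd_linearCombination, ← pd_coord b c y]
    · exact pd_congr (hy.mono fun z hz => hz c) b
    · exact fun γ => (EuclideanSpace.proj γ : Euc n →L[ℝ] ℝ).differentiableAt.comp y hd
  have h2 : ∑ γ, ℓ c γ * pd a (pd b (fun y => F y γ)) x = 0 := by
    rw [← pd_linearCombination, pd_congr (h1 c b) a, pd_const]
    exact fun γ => ((contDiffAt_component hF γ).pd (t := 1) b (by omega)).differentiableAt (by simp)
  have h3 := fun d => (h1 c d).self_of_nhds
  simp only [secondForm, Matrix.cons_val_zero, Matrix.cons_val_one]
  have h4 : ∀ γ, ℓ c γ * ((∑ α, ∑ β, christoffel G γ α β (F x)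
      * pd a (fun y => F y α) x * pd b (fun y => F y β) x)
      - (pd a (pd b (fun y => F y γ)) x + (∑ α, ∑ β, christoffel G γ α β (F x)
      * pd a (fun y => F y α) x * pd b (fun y => F y β) x)
      - ∑ d, christoffel h d a b x * pd d (fun y => F y γ) x))
      = (∑ d, christoffel h d a b x * (ℓ c γ * pd d (fun y => F y γ) x))
        - ℓ c γ * pd a (pd b (fun y => F y γ)) x := by
    intro γ
    have : ∀ d, christoffel h d a b x * (ℓ c γ * pd d (fun y => F y γ) x)
      = ℓ c γ * (christoffel h d a b x * pd d (fun y => F y γ) x) := fun d => by ring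
    simp only [this, ← Finset.mul_sum]
    ring
  rw [Finset.sum_congr rfl fun γ _ => h4 γ, Finset.sum_sub_distrib, h2, Finset.sum_comm]
  simp only [← Finset.mul_sum, h3]
  simp

end Algebra

/-- Bootstrap for the Gauss formula. The Christoffel symbols of `h` are only assumed differentiable:
their bounds come from `christoffel_eq_of_graph`, which is why `ℓ` is present. -/
theorem jetBounded_pd_of_higherForm {m n N : ℕ} {ι : Type*} {x : ι → Euc m}
    {F : ι → Euc m → Euc n} {G : ι → Euc n → Matrix (Fin n) (Fin n) ℝ}
    {h : ι → Euc m → Matrix (Fin m) (Fin m) ℝ} {ℓ : ι → Fin m → Fin n → ℝ}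
    (hF : ∀ i, ContDiffAt ℝ (N + 2 : ℕ) (F i) (x i))
    (hF1 : ∀ a γ, ∃ D : ℝ, ∀ i, ‖pd a (fun y => F i y γ) (x i)‖ ≤ D)
    (hG : ∀ γ α β, JetBounded (fun i => F i (x i)) N (fun i => christoffel (G i) γ α β))
    (hh : ∀ i c a b, ContDiffAt ℝ N (christoffel (h i) c a b) (x i))
    (hℓ : ∀ c γ, ∃ D : ℝ, ∀ i, ‖ℓ i c γ‖ ≤ D)
    (hℓF : ∀ i, ∀ᶠ y in 𝓝 (x i), ∀ c, ∑ γ, ℓ i c γ * F i y γ = y c)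
    (hA : ∀ j ≤ N, ∀ I γ, ∃ D : ℝ, ∀ i, ‖higherForm (h i) (G i) (F i) j (x i) I γ‖ ≤ D)
    (a : Fin m) (γ : Fin n) : JetBounded x (N + 1) (fun i => pd a (fun y => F i y γ)) := by
  have hF2 : ∀ i, ∀ᶠ y in 𝓝 (x i), ContDiffAt ℝ (N + 2 : ℕ) (F i) y :=
    fun i => (hF i).eventually (natCast_ne_infty _)
  have hℓc : ∀ s c γ, JetBounded x s (fun i (_ : Euc m) => ℓ i c γ) := fun s c γ => by
    obtain ⟨D, hD⟩ := hℓ c γ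
    exact JetBounded.const hD
  have hGF : ∀ d ≤ N, (∀ t, t + 1 ≤ d → ∀ a γ, JetBounded x t (fun i => pd a (fun y => F i y γ))) →
      ∀ γ α β, JetBounded x d (fun i y => christoffel (G i) γ α β (F i y)) := by
    intro d hd hP γ α β
    exact ((hG γ α β).mono hd).comp
      (fun i => (hF i).of_le (by exact_mod_cast (by omega))) hP
  have hch : ∀ d, (∀ a γ, JetBounded x d (fun i => pd a (fun y => F i y γ))) →
      (∀ γ α β, JetBounded x d (fun i y => christoffel (G i) γ α β (F i y))) →
      (∀ I γ, JetBounded x d (fun i y => higherForm (h i) (G i) (F i) 0 y I γ)) →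
      ∀ c a b, JetBounded x d (fun i => christoffel (h i) c a b) := by
    intro d h1 h2 h3 c a b
    have : JetBounded x d (fun i y => ∑ γ, ℓ i c γ * ((∑ α, ∑ β, christoffel (G i) γ α β (F i y)
        * pd a (fun y => F i y α) y * pd b (fun y => F i y β) y)
        - higherForm (h i) (G i) (F i) 0 y ![a, b] γ)) := by
      refine .sum fun γ _ => (hℓc d c γ).mul (.sub (.sum fun α _ => .sum fun β _ => ?_) (h3 _ _))
      exact ((h2 γ α β).mul (h1 a α)).mul (h1 b β)
    refine this.congr fun i => ?_
    filter_upwards [hF2 i, (hℓF i).eventually_nhds] with y hy hy'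
    exact christoffel_eq_of_graph (hy.of_le (by exact_mod_cast (by omega))) hy' c a b
  -- The Gauss formula solved for `∂∂F`: order `d` bounds on its ingredients give one more order for
  -- `∂F`.
  have hpd : ∀ d ≤ N, (∀ a γ, JetBounded x d (fun i => pd a (fun y => F i y γ))) →
      (∀ γ α β, JetBounded x d (fun i y => christoffel (G i) γ α β (F i y))) →
      (∀ I γ, JetBounded x d (fun i y => higherForm (h i) (G i) (F i) 0 y I γ)) →
      ∀ a γ, JetBounded x (d + 1) (fun i => pd a (fun y => F i y γ)) := by
    intro d hd h1 h2 h3 b γ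
    refine .succ_of_pd (h1 b γ).value_le
      (fun i => (contDiffAt_component (hF i) γ).pd b (by omega)) fun a => ?_
    have h4 := hch d h1 h2 h3
    have : JetBounded x d (fun i y => higherForm (h i) (G i) (F i) 0 y ![a, b] γ
        - (∑ α, ∑ β, christoffel (G i) γ α β (F i y)
        * pd a (fun y => F i y α) y * pd b (fun y => F i y β) y)
        + ∑ c, christoffel (h i) c a b y * pd c (fun y => F i y γ) y) := by
      refine .add (.sub (h3 _ _) (.sum fun α _ => .sum fun β _ => ?_)) (.sum fun c _ => ?_)
      · exact ((h2 γ α β).mul (h1 a α)).mul (h1 b β)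
      · exact (h4 c a b).mul (h1 c γ)
    convert this using 3 with i y
    simp only [higherForm, secondForm, Matrix.cons_val_zero, Matrix.cons_val_one]
    ring
  -- The order `d` of differentiation is traded against the order `j` of the form. Reaching order `d
  -- + 1` for `∇^j II` uses order `d` for `∇^{j+1} II`, which the constraint `j + d ≤ N` makes
  -- available.
  have main : ∀ d ≤ N,
      (∀ a γ, JetBounded x d (fun i => pd a (fun y => F i y γ))) ∧
      (∀ γ α β, JetBounded x d (fun i y => christoffel (G i) γ α β (F i y))) ∧
      (∀ j, j + d ≤ N → ∀ I γ, JetBounded x d (fun i y => higherForm (h i) (G i) (F i) j y I γ)) := by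
    intro d
    induction d with
    | zero =>
      intro _
      refine ⟨fun a γ => ?_, hGF 0 (by omega) (fun t ht => by omega), fun j hj I γ => ?_⟩
      · exact JetBounded.zero_iff.2
          ⟨fun i => (contDiffAt_component (hF i) γ).pd a (by omega), hF1 a γ⟩
      · exact JetBounded.zero_iff.2 ⟨fun i => contDiffAt_higherForm (hF i)
          (fun γ α β => (hG γ α β).1 i) (hh i) j 0 hj I γ, hA j (by omega) I γ⟩
    | succ d ih =>
      intro hd
      obtain ⟨h1, h2, h3⟩ := ih (by omega)
      have h1' := hpd d (by omega) h1 h2 (h3 0 (by omega))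
      have hc := hch d h1 h2 (h3 0 (by omega))
      refine ⟨h1', hGF (d + 1) hd fun t ht a γ => (h1 a γ).mono (by omega), fun j hj I γ => ?_⟩
      refine .succ_of_pd (h3 j (by omega) I γ).value_le (fun i => contDiffAt_higherForm (hF i)
          (fun γ α β => (hG γ α β).1 i) (hh i) j (d + 1) hj I γ) fun a => ?_
      -- The definition of the covariant derivative, solved for the partial derivative of `∇^j II`.
      have : JetBounded x d (fun i y => higherForm (h i) (G i) (F i) (j + 1) y (Fin.cons a I) γ
          - (∑ α, ∑ β, christoffel (G i) γ α β (F i y)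
          * pd a (fun y => F i y α) y * higherForm (h i) (G i) (F i) j y I β)
          + ∑ l, ∑ c, christoffel (h i) c a (I l) y
            * higherForm (h i) (G i) (F i) j y (Function.update I l c) γ) := by
        refine .add (.sub (h3 (j + 1) (by omega) _ _) (.sum fun α _ => .sum fun β _ => ?_))
          (.sum fun l _ => .sum fun c _ => ?_)
        · exact ((h2 γ α β).mul (h1 a α)).mul (h3 j (by omega) _ _)
        · exact (hc c a (I l)).mul (h3 j (by omega) _ _)
      convert this using 3 with i y
      simp only [higherForm, covDeriv, Fin.cons_zero, Fin.tail_cons]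
      ring
  obtain ⟨h1, h2, h3⟩ := main N le_rfl
  exact hpd N le_rfl h1 h2 (h3 0 (by omega)) a γ

/-! ### Continuation of local sections -/

section Sections

open Filter Metric

variable {X E : Type*} [TopologicalSpace X] [NormedAddCommGroup E]

/-- `α` is a continuous section over `D` of `pr`, with values in `U` and base point `p`. -/
structure IsSection (pr : X → E) (U : Set X) (p : X) (D : Set E) (α : E → X) : Prop where
  continuousOn : ContinuousOn α D
  mem : ∀ x ∈ D, α x ∈ U
  right_inv : ∀ x ∈ D, pr (α x) = x
  map_zero : α 0 = p

/-- `pr` restricts to a local homeomorphism on the set `U`, which is open. -/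
def LocallyHomeoOn (pr : X → E) (U : Set X) : Prop :=
  ∀ q ∈ U, ∃ e : OpenPartialHomeomorph X E, q ∈ e.source ∧ e.source ⊆ U ∧ EqOn e pr e.source

variable {pr : X → E} {U : Set X} {p : X} {D D' : Set E} {α β : E → X}

lemma IsSection.mono (h : IsSection pr U p D α) (hD : D' ⊆ D) : IsSection pr U p D' α :=
  ⟨h.continuousOn.mono hD, fun x hx => h.mem x (hD hx), fun x hx => h.right_inv x (hD hx),
    h.map_zero⟩

lemma LocallyHomeoOn.continuousAt (hpr : LocallyHomeoOn pr U) {q : X} (hq : q ∈ U) :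
    ContinuousAt pr q := by
  obtain ⟨e, h1, -, h3⟩ := hpr q hq
  exact (e.continuousAt h1).congr (h3.eventuallyEq_of_mem (e.open_source.mem_nhds h1))

lemma LocallyHomeoOn.exists_injOn (hpr : LocallyHomeoOn pr U) {q : X} (hq : q ∈ U) :
    ∃ u ∈ 𝓝 q, InjOn pr u := by
  obtain ⟨e, h1, -, h3⟩ := hpr q hq
  exact ⟨e.source, e.open_source.mem_nhds h1, e.injOn.congr h3⟩

lemma LocallyHomeoOn.isOpen (hpr : LocallyHomeoOn pr U) : IsOpen U := by
  refine isOpen_iff_mem_nhds.2 fun q hq => ?_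
  obtain ⟨e, h1, h2, -⟩ := hpr q hq
  exact mem_of_superset (e.open_source.mem_nhds h1) h2

lemma LocallyHomeoOn.isOpen_image (hpr : LocallyHomeoOn pr U) {W : Set X} (hW : IsOpen W)
    (hWU : W ⊆ U) : IsOpen (pr '' W) := by
  refine isOpen_iff_mem_nhds.2 ?_
  rintro _ ⟨q, hq, rfl⟩
  obtain ⟨e, h1, h2, h3⟩ := hpr q (hWU hq)
  have h4 : IsOpen (e '' (e.source ∩ W)) := e.isOpen_image_source_inter hW
  refine mem_of_superset (h4.mem_nhds ⟨q, ⟨h1, hq⟩, h3 h1⟩) ?_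
  rintro _ ⟨y, ⟨hy1, hy2⟩, rfl⟩
  exact ⟨y, hy2, (h3 hy1).symm⟩

/-- Uniqueness of lifts: `pr` is separated and locally injective on `U`, so lifts that agree at `0`
agree on a connected set. -/
lemma LocallyHomeoOn.eqOn_sections [T2Space X] (hpr : LocallyHomeoOn pr U)
    (hα : IsSection pr U p D α) (hβ : IsSection pr U p D β) (hD : IsPreconnected D)
    (h0 : (0 : E) ∈ D) : EqOn α β D := by
  have : PreconnectedSpace D := isPreconnected_iff_preconnectedSpace.1 hD
  have inj : IsLocallyInjective (fun q : U => pr q) := by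
    intro q
    obtain ⟨e, h1, -, h3⟩ := hpr q q.2
    refine ⟨(fun q : U => (q : X)) ⁻¹' e.source, e.open_source.preimage continuous_subtype_val, h1,
      fun a ha b hb hab => Subtype.ext ?_⟩
    exact (e.injOn.congr h3) ha hb hab
  have sep : IsSeparatedMap (fun q : U => pr q) := T2Space.isSeparatedMap _
  have := sep.eq_of_comp_eq inj
    (g₁ := fun x : D => (⟨α x, hα.mem x x.2⟩ : U)) (g₂ := fun x : D => (⟨β x, hβ.mem x x.2⟩ : U))
    (continuousOn_iff_continuous_domRestrict.1 hα.continuousOn |>.subtype_mk _)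
    (continuousOn_iff_continuous_domRestrict.1 hβ.continuousOn |>.subtype_mk _)
    (funext fun x => (hα.right_inv x x.2).trans (hβ.right_inv x x.2).symm) ⟨0, h0⟩
    (Subtype.ext (hα.map_zero.trans hβ.map_zero.symm))
  intro x hx
  exact congrArg Subtype.val (congrFun this ⟨x, hx⟩)

/-- A locally injective map that is injective on the compact set `α '' K` is injective on a
neighbourhood of it. The inverse of `pr` on that neighbourhood extends `α`, and it is continuous
because `pr` is open. -/
lemma LocallyHomeoOn.exists_section_superset (hpr : LocallyHomeoOn pr U) {K : Set E}
    (hK : IsCompact K) (h0 : (0 : E) ∈ K) (hα : IsSection pr U p K α) :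
    ∃ O, IsOpen O ∧ K ⊆ O ∧ ∃ β, IsSection pr U p O β := by
  have hc : IsCompact (α '' K) := hK.image_of_continuousOn hα.continuousOn
  have hKU : α '' K ⊆ U := by rintro _ ⟨x, hx, rfl⟩; exact hα.mem x hx
  have inj : InjOn pr (α '' K) := by
    rintro _ ⟨x, hx, rfl⟩ _ ⟨y, hy, rfl⟩ hxy
    rw [hα.right_inv x hx, hα.right_inv y hy] at hxy
    rw [hxy]
  obtain ⟨W, hW, hKW, hinj⟩ := inj.exists_isOpen_superset hc
    (fun x hx => hpr.continuousAt (hKU hx)) (fun x hx => hpr.exists_injOn (hKU hx))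
  have hWU : IsOpen (W ∩ U) := hW.inter hpr.isOpen
  have hinj' : InjOn pr (W ∩ U) := hinj.mono inter_subset_left
  have hne : Nonempty X := ⟨p⟩
  have hinv : ∀ q ∈ W ∩ U, Function.invFunOn pr (W ∩ U) (pr q) = q :=
    fun q hq => hinj'.leftInvOn_invFunOn hq
  refine ⟨pr '' (W ∩ U), hpr.isOpen_image hWU inter_subset_right, ?_,
    Function.invFunOn pr (W ∩ U), ?_, ?_, ?_, ?_⟩
  · intro x hx
    exact ⟨α x, ⟨hKW ⟨x, hx, rfl⟩, hα.mem x hx⟩, hα.right_inv x hx⟩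
  · rintro _ ⟨q, hq, rfl⟩
    refine ContinuousAt.continuousWithinAt ?_
    rw [ContinuousAt, hinv q hq]
    intro V hV
    obtain ⟨V', hV', hV'o, hqV'⟩ := mem_nhds_iff.1 hV
    have h1 : IsOpen (pr '' (V' ∩ (W ∩ U))) :=
      hpr.isOpen_image (hV'o.inter hWU) (inter_subset_right.trans inter_subset_right)
    refine mem_map.2 (mem_of_superset (h1.mem_nhds ⟨q, ⟨hqV', hq⟩, rfl⟩) ?_)
    rintro _ ⟨q', ⟨h2, h3⟩, rfl⟩
    rw [mem_preimage, hinv q' h3]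
    exact hV' h2
  · rintro _ ⟨q, hq, rfl⟩
    rw [hinv q hq]; exact hq.2
  · rintro _ ⟨q, hq, rfl⟩
    rw [hinv q hq]
  · have h1 := hinv (α 0) ⟨hKW ⟨0, h0, rfl⟩, hα.mem 0 h0⟩
    rwa [hα.right_inv 0 h0, hα.map_zero] at h1

/-- If sections of `pr` over balls of radius less than `R` have limits in `U` at the boundary, then
there is a section over the ball of radius `R`. -/
theorem LocallyHomeoOn.exists_section_ball [T3Space X] [NormedSpace ℝ E] [ProperSpace E] (hpr : LocallyHomeoOn pr U)
    (hp : p ∈ U) (hp0 : pr p = 0) {R : ℝ} (hR : 0 < R)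
    (hext : ∀ s, 0 < s → s < R → ∀ α, IsSection pr U p (ball 0 s) α →
      ∀ z ∈ sphere (0 : E) s, ∃ q ∈ U, Tendsto α (𝓝[ball 0 s] z) (𝓝 q)) :
    ∃ α, IsSection pr U p (ball 0 R) α := by
  have hgrow : ∀ s α, IsSection pr U p (closedBall 0 s) α → 0 ≤ s →
      ∃ t > s, ∃ β, IsSection pr U p (ball 0 t) β := by
    intro s α hα hs
    obtain ⟨O, hO, hKO, β, hβ⟩ := hpr.exists_section_superset (isCompact_closedBall 0 s)
      (mem_closedBall_self hs) hα
    obtain ⟨δ, hδ, h⟩ := (isCompact_closedBall (0 : E) s).exists_thickening_subset_open hO hKO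
    refine ⟨s + δ, by linarith, β, hβ.mono (subset_trans ?_ h)⟩
    rw [thickening_closedBall hδ hs, add_comm]
  let T : Set ℝ := {s | 0 < s ∧ s ≤ R ∧ ∃ α, IsSection pr U p (ball 0 s) α}
  have hTne : T.Nonempty := by
    -- The closed ball of radius `0` is the point `0`, over which the constant map `p` is a section.
    obtain ⟨t, ht, β, hβ⟩ := hgrow 0 (fun _ => p) ⟨continuousOn_const, fun _ _ => hp,
      fun x hx => by simpa [hp0, eq_comm] using hx, rfl⟩ le_rfl
    exact ⟨min t R, lt_min ht hR, min_le_right _ _, β, hβ.mono (ball_subset_ball (min_le_left _ _))⟩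
  have hTb : BddAbove T := ⟨R, fun s hs => hs.2.1⟩
  have hTR : sSup T ≤ R := csSup_le hTne fun s hs => hs.2.1
  have hT0 : 0 < sSup T := by
    obtain ⟨s, hs⟩ := hTne
    exact hs.1.trans_le (le_csSup hTb hs)
  have hsec : ∀ s < sSup T, ∃ α, IsSection pr U p (ball 0 s) α := by
    intro s hs
    obtain ⟨t, ht, hst⟩ := exists_lt_of_lt_csSup hTne hs
    obtain ⟨α, hα⟩ := ht.2.2
    exact ⟨α, hα.mono (ball_subset_ball hst.le)⟩
  have hne : Nonempty (E → X) := ⟨fun _ => p⟩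
  choose! σ hσ using hsec
  -- The sections over smaller balls agree on overlaps. To glue them, the value at `x` is taken from
  -- the section whose radius is halfway between `‖x‖` and the supremum.
  let rad : E → ℝ := fun x => (‖x‖ + sSup T) / 2
  have hrad : ∀ x ∈ ball (0 : E) (sSup T), ‖x‖ < rad x ∧ rad x < sSup T := fun x hx => by
    rw [mem_ball_zero_iff] at hx
    constructor <;> simp only [rad] <;> linarith
  have hcomp : ∀ s < sSup T, EqOn (fun x => σ (rad x) x) (σ s) (ball 0 s) := by
    intro s hs x hx
    have hxs : x ∈ ball (0 : E) (sSup T) := ball_subset_ball hs.le hx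
    rw [mem_ball_zero_iff] at hx
    obtain ⟨h1, h2⟩ := hrad x hxs
    have h3 : 0 < min (rad x) s := lt_min ((norm_nonneg x).trans_lt h1) ((norm_nonneg x).trans_lt hx)
    refine hpr.eqOn_sections ((hσ _ h2).mono (ball_subset_ball (min_le_left _ s)))
      ((hσ s hs).mono (ball_subset_ball (min_le_right (rad x) _)))
      (convex_ball _ _).isPreconnected (mem_ball_self h3) ?_
    rw [mem_ball_zero_iff]; exact lt_min h1 hx
  have hfull : IsSection pr U p (ball 0 (sSup T)) (fun x => σ (rad x) x) := by
    refine ⟨fun x hx => ?_, fun x hx => ?_, fun x hx => ?_, ?_⟩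
    · obtain ⟨h1, h2⟩ := hrad x hx
      have hm : ball (0 : E) (rad x) ∈ 𝓝 x := isOpen_ball.mem_nhds (mem_ball_zero_iff.2 h1)
      exact (((hσ _ h2).continuousOn.continuousAt hm).congr
        ((hcomp _ h2).symm.eventuallyEq_of_mem hm)).continuousWithinAt
    · obtain ⟨h1, h2⟩ := hrad x hx
      exact (hσ _ h2).mem x (mem_ball_zero_iff.2 h1)
    · obtain ⟨h1, h2⟩ := hrad x hx
      exact (hσ _ h2).right_inv x (mem_ball_zero_iff.2 h1)
    · exact (hσ _ (hrad 0 (mem_ball_self hT0)).2).map_zero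
  rcases hTR.eq_or_lt with heq | hlt
  · exact ⟨_, heq ▸ hfull⟩
  exfalso
  -- If the supremum were less than `R`, the boundary limits would extend the section continuously
  -- to the closed ball and then, by `hgrow`, beyond it.
  set s := sSup T with hs
  set α : E → X := fun x => σ (rad x) x with hα
  have hcl : closedBall (0 : E) s ⊆ closure (ball 0 s) := (closure_ball 0 hT0.ne').ge
  have hlim : ∀ z ∈ closedBall (0 : E) s, ∃ q ∈ U, Tendsto α (𝓝[ball 0 s] z) (𝓝 q) := by
    intro z hz
    rcases (mem_closedBall_zero_iff.1 hz).lt_or_eq with h | h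
    · exact ⟨α z, hfull.mem z (mem_ball_zero_iff.2 h), hfull.continuousOn z (mem_ball_zero_iff.2 h)⟩
    · exact hext s hT0 hlt α hfull z (mem_sphere_zero_iff_norm.2 h)
  have hval : ∀ z ∈ closedBall (0 : E) s, extendFrom (ball 0 s) α z ∈ U ∧
      Tendsto α (𝓝[ball 0 s] z) (𝓝 (extendFrom (ball 0 s) α z)) := by
    intro z hz
    obtain ⟨q, hq, h⟩ := hlim z hz
    rw [extendFrom_eq (hcl hz) h]
    exact ⟨hq, h⟩
  have hbar : IsSection pr U p (closedBall 0 s) (extendFrom (ball 0 s) α) := by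
    refine ⟨continuousOn_extendFrom hcl fun z hz => ?_, fun z hz => (hval z hz).1,
      fun z hz => ?_, ?_⟩
    · obtain ⟨q, -, h⟩ := hlim z hz
      exact ⟨q, h⟩
    · have hne : (𝓝[ball 0 s] z).NeBot := mem_closure_iff_nhdsWithin_neBot.1 (hcl hz)
      have h1 : Tendsto (pr ∘ α) (𝓝[ball 0 s] z) (𝓝 (pr (extendFrom (ball 0 s) α z))) :=
        (hpr.continuousAt (hval z hz).1).tendsto.comp (hval z hz).2
      have h2 : Tendsto (pr ∘ α) (𝓝[ball 0 s] z) (𝓝 z) := by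
        refine (tendsto_id.mono_left nhdsWithin_le_nhds).congr' ?_
        filter_upwards [self_mem_nhdsWithin] with x hx using (hfull.right_inv x hx).symm
      exact tendsto_nhds_unique h1 h2
    · have h0 := mem_ball_self (x := (0 : E)) hT0
      rw [extendFrom_eq (subset_closure h0) (hfull.continuousOn 0 h0)]
      exact hfull.map_zero
  obtain ⟨t, ht, β, hβ⟩ := hgrow s _ hbar hT0.le
  have hmem : min t R ∈ T := ⟨lt_min (hT0.trans ht) hR, min_le_right _ _, β,
    hβ.mono (ball_subset_ball (min_le_left _ _))⟩
  exact absurd (le_csSup hTb hmem) (not_le.2 (lt_min ht hlt))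

end Sections

/-! ### Bounds on metrics and tensors -/

section Matrices

open Matrix

variable {m n d : ℕ}

lemma sum_quadratic_eq_inner (G : Matrix (Fin d) (Fin d) ℝ) (v w : Euc d) :
    ∑ γ, ∑ δ, G γ δ * v γ * w δ = inner ℝ v (toEuclideanCLM (𝕜 := ℝ) G w) := by
  simp only [PiLp.inner_apply, ofLp_toEuclideanCLM, mulVec, dotProduct, RCLike.inner_apply,
    conj_trivial, Finset.sum_mul]
  exact Finset.sum_congr rfl fun γ _ => Finset.sum_congr rfl fun δ _ => by ring

lemma quadratic_le_of_norm_le {G : Matrix (Fin d) (Fin d) ℝ} {Γ : ℝ}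
    (hG : ‖toEuclideanCLM (𝕜 := ℝ) G‖ ≤ Γ) (w : Euc d) :
    ∑ γ, ∑ δ, G γ δ * w γ * w δ ≤ Γ * ‖w‖ ^ 2 := by
  rw [sum_quadratic_eq_inner]
  calc inner ℝ w (toEuclideanCLM (𝕜 := ℝ) G w) ≤ ‖w‖ * ‖toEuclideanCLM (𝕜 := ℝ) G w‖ :=
        real_inner_le_norm _ _
    _ ≤ ‖w‖ * (Γ * ‖w‖) := by
        gcongr
        exact ContinuousLinearMap.le_of_opNorm_le _ hG w
    _ = Γ * ‖w‖ ^ 2 := by ring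

/-- Put `u = G⁻¹ w`. Positivity of `G` on `w - Γ⁻¹ u`, together with `⟨u, w⟩ ≤ Γ ‖w‖²`, gives the
lower bound without eigenvalues. -/
lemma norm_sq_le_quadratic_of_inv {G : Matrix (Fin d) (Fin d) ℝ} {Γ : ℝ} (hΓ : 0 < Γ)
    (hpos : G.PosDef) (hG : ‖toEuclideanCLM (𝕜 := ℝ) G⁻¹‖ ≤ Γ) (w : Euc d) :
    ‖w‖ ^ 2 ≤ Γ * ∑ γ, ∑ δ, G γ δ * w γ * w δ := by
  rw [sum_quadratic_eq_inner]
  set T := toEuclideanCLM (𝕜 := ℝ) G with hT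
  set u := toEuclideanCLM (𝕜 := ℝ) G⁻¹ w with hu
  have hTu : T u = w := by
    rw [hu, hT, ← mul_apply_eq_comp, ← map_mul,
      mul_nonsing_inv _ (isUnit_iff_ne_zero.2 hpos.det_pos.ne'), map_one]
    rfl
  have hsymm : ∀ a b : Euc d, inner ℝ a (T b) = inner ℝ b (T a) := by
    intro a b
    rw [hT, ← sum_quadratic_eq_inner, ← sum_quadratic_eq_inner, Finset.sum_comm]
    refine Finset.sum_congr rfl fun γ _ => Finset.sum_congr rfl fun δ _ => ?_
    have := hpos.isHermitian.apply γ δ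
    simp only [star_trivial] at this
    rw [this]; ring
  have hnonneg : ∀ a : Euc d, 0 ≤ inner ℝ a (T a) := by
    intro a
    have := hpos.posSemidef.dotProduct_mulVec_nonneg a.ofLp
    rw [inner_toEuclideanCLM]
    simpa using this
  have h1 := hnonneg (w - Γ⁻¹ • u)
  rw [map_sub, map_smul, hTu] at h1
  simp only [inner_sub_left, inner_sub_right, inner_smul_left, inner_smul_right, conj_trivial] at h1
  have h2 : inner ℝ u (T w) = ‖w‖ ^ 2 := by rw [hsymm, hTu, real_inner_self_eq_norm_sq]
  have h3 : inner ℝ u w ≤ Γ * ‖w‖ ^ 2 := by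
    calc inner ℝ u w ≤ ‖u‖ * ‖w‖ := real_inner_le_norm _ _
      _ ≤ (Γ * ‖w‖) * ‖w‖ := by
          gcongr
          exact ContinuousLinearMap.le_of_opNorm_le _ hG w
      _ = Γ * ‖w‖ ^ 2 := by ring
  rw [h2, real_inner_self_eq_norm_sq] at h1
  have h4 : Γ⁻¹ * (Γ⁻¹ * inner ℝ u w) ≤ Γ⁻¹ * ‖w‖ ^ 2 := by
    have : Γ⁻¹ * inner ℝ u w ≤ ‖w‖ ^ 2 := by
      rw [inv_mul_le_iff₀ hΓ]; exact h3
    gcongr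
  have h5 : Γ⁻¹ * ‖w‖ ^ 2 ≤ inner ℝ w (T w) := by linarith
  rwa [inv_mul_le_iff₀ hΓ] at h5

lemma contDiffAt_det {E : Type*} [NormedAddCommGroup E] [NormedSpace ℝ E] {s : WithTop ℕ∞} {x : E}
    {G : E → Matrix (Fin d) (Fin d) ℝ} (hG : ∀ a b, ContDiffAt ℝ s (fun y => G y a b) x) :
    ContDiffAt ℝ s (fun y => (G y).det) x := by
  simp only [det_apply']
  exact ContDiffAt.sum fun σ _ => contDiffAt_const.mul (contDiffAt_prod fun i _ => hG _ _)

lemma contDiffAt_inv_apply {E : Type*} [NormedAddCommGroup E] [NormedSpace ℝ E] {s : WithTop ℕ∞}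
    {x : E} {G : E → Matrix (Fin d) (Fin d) ℝ} (hG : ∀ a b, ContDiffAt ℝ s (fun y => G y a b) x)
    (hx : (G x).det ≠ 0) (a b : Fin d) : ContDiffAt ℝ s (fun y => (G y)⁻¹ a b) x := by
  -- Cramer's rule: an entry of the adjugate is the determinant of `G` with one row replaced by a
  -- constant.
  simp only [inv_def, Ring.inverse_eq_inv', Matrix.smul_apply, smul_eq_mul, adjugate_apply]
  refine ((contDiffAt_det hG).inv hx).mul (contDiffAt_det fun i j => ?_)
  by_cases h : i = b
  · subst h
    simpa using contDiffAt_const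
  · simpa [updateRow_ne h] using hG i j

lemma toEuclideanCLM_eq_sum (G : Matrix (Fin d) (Fin d) ℝ) :
    toEuclideanCLM (𝕜 := ℝ) G
      = ∑ a, ∑ b, G a b • toEuclideanCLM (𝕜 := ℝ) (Matrix.single a b (1 : ℝ)) := by
  conv_lhs => rw [matrix_eq_sum_single G]
  simp only [map_sum]
  refine Finset.sum_congr rfl fun a _ => Finset.sum_congr rfl fun b _ => ?_
  rw [← map_smul, Matrix.smul_single]
  simp

lemma contDiffAt_toEuclideanCLM {E : Type*} [NormedAddCommGroup E] [NormedSpace ℝ E]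
    {s : WithTop ℕ∞} {x : E} {G : E → Matrix (Fin d) (Fin d) ℝ}
    (hG : ∀ a b, ContDiffAt ℝ s (fun y => G y a b) x) :
    ContDiffAt ℝ s (fun y => toEuclideanCLM (𝕜 := ℝ) (G y)) x := by
  simp_rw [fun y => toEuclideanCLM_eq_sum (G y)]
  exact ContDiffAt.sum fun a _ => ContDiffAt.sum fun b _ => (hG a b).smul contDiffAt_const

lemma JetBounded.entry {ι E : Type*} [NormedAddCommGroup E] [NormedSpace ℝ E] {x : ι → E} {s : ℕ}
    {G : ι → E → Matrix (Fin d) (Fin d) ℝ}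
    (hG : JetBounded x s (fun i y => toEuclideanCLM (𝕜 := ℝ) (G i y))) (a b : Fin d) :
    JetBounded x s (fun i y => G i y a b) := by
  have := hG.clm (L := fun _ => (EuclideanSpace.proj a : Euc d →L[ℝ] ℝ).comp
    (ContinuousLinearMap.apply ℝ (Euc d) (EuclideanSpace.single b (1 : ℝ) : Euc d)))
    (fun _ => le_rfl)
  convert this using 3 with i y
  simp [ofLp_toEuclideanCLM]

lemma contDiffAt_christoffel {G : Euc d → Matrix (Fin d) (Fin d) ℝ} {x : Euc d} {N : ℕ}
    (hG : ∀ a b, ContDiffAt ℝ (N + 1 : ℕ) (fun y => G y a b) x) (hx : (G x).det ≠ 0)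
    (c a b : Fin d) : ContDiffAt ℝ N (christoffel G c a b) x := by
  have h1 : ∀ e a b, ContDiffAt ℝ N (pd e (fun y => G y a b)) x := fun e a b => (hG a b).pd e le_rfl
  have h2 : ∀ a b, ContDiffAt ℝ N (fun y => (G y)⁻¹ a b) x := fun a b =>
    (contDiffAt_inv_apply hG hx a b).of_le (by exact_mod_cast (by omega))
  exact contDiffAt_const.mul (ContDiffAt.sum fun e _ =>
    (h2 c e).mul (((h1 _ _ _).add (h1 _ _ _)).sub (h1 _ _ _)))

lemma JetBounded.christoffel {ι : Type*} {G : ι → Euc d → Matrix (Fin d) (Fin d) ℝ}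
    {x : ι → Euc d} {N : ℕ}
    (hG : JetBounded x (N + 1) (fun i y => toEuclideanCLM (𝕜 := ℝ) (G i y)))
    (hG' : JetBounded x (N + 1) (fun i y => toEuclideanCLM (𝕜 := ℝ) (G i y)⁻¹)) (c a b : Fin d) :
    JetBounded x N (fun i => SubmanifoldGraph.christoffel (G i) c a b) := by
  have h1 : ∀ e a b, JetBounded x N (fun i => SubmanifoldGraph.pd e (fun y => G i y a b)) :=
    fun e a b => (hG.entry a b).pd e
  have h2 : ∀ a b, JetBounded x N (fun i y => (G i y)⁻¹ a b) := fun a b =>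
    (JetBounded.entry (G := fun i y => (G i y)⁻¹) hG' a b).mono (by omega)
  exact (const (c := fun _ => (1 / 2 : ℝ)) (fun _ => le_rfl)).mul (.sum fun e _ =>
    (h2 c e).mul (((h1 _ _ _).add (h1 _ _ _)).sub (h1 _ _ _)))

/-- The vectors `e_a / √H` are admissible in the supremum because `h a a ≤ H`. Testing on them gives
`√H ^ (-j)` times a component vector, and the bound on `G⁻¹` turns its `G`-norm into a Euclidean
norm. -/
lemma component_le_of_tensorNorm_le {j : ℕ} {h : Matrix (Fin m) (Fin m) ℝ}
    {G : Matrix (Fin n) (Fin n) ℝ} {T : (Fin j → Fin m) → Fin n → ℝ} {Γ B H : ℝ} (hΓ : 0 < Γ)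
    (hB : 0 ≤ B) (hH : 0 < H)
    (hpos : G.PosDef) (hG : ‖toEuclideanCLM (𝕜 := ℝ) G⁻¹‖ ≤ Γ) (hh : ∀ a, h a a ≤ H)
    (hT : tensorNorm h G T ≤ ENNReal.ofReal B) (I : Fin j → Fin m) (γ : Fin n) :
    |T I γ| ≤ √Γ * B * √H ^ j := by
  classical
  have hsH : 0 < √H := Real.sqrt_pos.2 hH
  let v : Fin j → Fin m → ℝ := fun l => Pi.single (I l) (√H)⁻¹
  have hv : v ∈ {v : Fin j → Fin m → ℝ | ∀ l, ∑ a, ∑ b, h a b * v l a * v l b ≤ 1} := by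
    intro l
    simp only [v, Pi.single_apply, mul_ite, ite_mul, zero_mul, mul_zero, Finset.sum_ite_eq', Finset.mem_univ, if_true]
    rw [mul_assoc, ← mul_inv, Real.mul_self_sqrt hH.le, ← div_eq_mul_inv, div_le_one hH]
    exact hh _
  have hS : ∀ γ, (∑ J : Fin j → Fin m, (∏ l, v l (J l)) * T J γ) = (√H)⁻¹ ^ j * T I γ := by
    intro γ
    rw [Finset.sum_eq_single I]
    · simp [v]
    · intro J _ hJ
      obtain ⟨l, hl⟩ := Function.ne_iff.1 hJ
      rw [Finset.prod_eq_zero (Finset.mem_univ l), zero_mul]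
      simp [v, hl]
    · simp
  have h1 := (le_iSup₂ (f := fun (v : Fin j → Fin m → ℝ)
    (_ : v ∈ {v : Fin j → Fin m → ℝ | ∀ l, ∑ a, ∑ b, h a b * v l a * v l b ≤ 1}) =>
    ENNReal.ofReal (√(∑ γ, ∑ δ, G γ δ
      * (∑ I : Fin j → Fin m, (∏ l, v l (I l)) * T I γ)
      * (∑ I : Fin j → Fin m, (∏ l, v l (I l)) * T I δ)))) v hv).trans hT
  simp only [hS] at h1
  rw [ENNReal.ofReal_le_ofReal_iff hB] at h1
  let w : Euc n := WithLp.toLp 2 fun γ => (√H)⁻¹ ^ j * T I γ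
  have h2 := norm_sq_le_quadratic_of_inv hΓ hpos hG w
  have h3 : ∑ γ, ∑ δ, G γ δ * w γ * w δ ≤ B ^ 2 := (Real.sqrt_le_left hB).1 h1
  have h4 : |w γ| ≤ √Γ * B := by
    have h5 : |w γ| ≤ ‖w‖ := PiLp.norm_apply_le w γ
    refine h5.trans (abs_le_of_sq_le_sq' ?_ (by positivity)).2
    rw [mul_pow, Real.sq_sqrt hΓ.le]
    exact h2.trans (by gcongr)
  have h5 : |w γ| = (√H)⁻¹ ^ j * |T I γ| := by
    simp only [w]
    rw [abs_mul, abs_of_nonneg (by positivity)]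
  rw [h5, inv_pow, inv_mul_le_iff₀ (by positivity)] at h4
  linarith

end Matrices

/-! ### The derivative estimate -/

section Estimate

open Matrix

/-- A germ of a submanifold of type `C^{N+2}` at the point `F x`, parametrised by tangential
coordinates `ℓ`, in a coordinate domain with metric matrix `G`, whose metric is bounded by `Γ` in
`C^{N+1}` and whose second fundamental form is bounded by `B` with its first `N` covariant
derivatives. -/
structure GraphGerm (m n N : ℕ) (Γ B : ℝ) where
  /-- the base point -/
  x : Euc m
  /-- the parametrisation -/
  F : Euc m → Euc n
  /-- the ambient metric -/
  G : Euc n → Matrix (Fin n) (Fin n) ℝ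
  /-- the induced metric -/
  h : Euc m → Matrix (Fin m) (Fin m) ℝ
  /-- the tangential coordinates -/
  ℓ : Euc n →L[ℝ] Euc m
  contDiffAt : ContDiffAt ℝ (N + 2 : ℕ) F x
  norm_fderiv_le : ‖fderiv ℝ F x‖ ≤ 2
  norm_ℓ_le : ‖ℓ‖ ≤ 1
  ℓ_comp : ∀ᶠ y in 𝓝 x, ℓ (F y) = y
  contDiffAt_G : ∀ a b, ContDiffAt ℝ (N + 1 : ℕ) (fun y => G y a b) (F x)
  posDef : (G (F x)).PosDef
  norm_G_le : ∀ j ≤ N + 1,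
    ‖iteratedFDeriv ℝ j (fun y => toEuclideanCLM (𝕜 := ℝ) (G y)) (F x)‖ ≤ Γ
  norm_inv_G_le : ∀ j ≤ N + 1,
    ‖iteratedFDeriv ℝ j (fun y => toEuclideanCLM (𝕜 := ℝ) (G y)⁻¹) (F x)‖ ≤ Γ
  h_eq : ∀ᶠ y in 𝓝 x, ∀ a b, h y a b = ∑ α, ∑ β, G (F y) α β
    * pd a (fun z => F z α) y * pd b (fun z => F z β) y
  tensorNorm_le : ∀ j ≤ N,
    tensorNorm (h x) (G (F x)) (higherForm h G F j x) ≤ ENNReal.ofReal B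

namespace GraphGerm

variable {m n N : ℕ} {Γ B : ℝ} (D : GraphGerm m n N Γ B)

lemma pd_apply_eq {F : Euc m → Euc n} {x : Euc m} (hF : DifferentiableAt ℝ F x) (a : Fin m)
    (γ : Fin n) : pd a (fun y => F y γ) x = fderiv ℝ F x (EuclideanSpace.single a 1) γ := by
  have h3 : fderiv ℝ (fun y => F y γ) x
      = (EuclideanSpace.proj γ : Euc n →L[ℝ] ℝ).comp (fderiv ℝ F x) :=
    ((EuclideanSpace.proj γ : Euc n →L[ℝ] ℝ).hasFDerivAt.comp x hF.hasFDerivAt).fderiv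
  simp [pd, h3]

lemma fderiv_apply_component {F : Euc m → Euc n} {x : Euc m} (hF : DifferentiableAt ℝ F x)
    (v : Euc m) (γ : Fin n) : fderiv ℝ F x v γ = ∑ a, v a * pd a (fun y => F y γ) x := by
  have h3 : fderiv ℝ (fun y => F y γ) x
      = (EuclideanSpace.proj γ : Euc n →L[ℝ] ℝ).comp (fderiv ℝ F x) :=
    ((EuclideanSpace.proj γ : Euc n →L[ℝ] ℝ).hasFDerivAt.comp x hF.hasFDerivAt).fderiv
  rw [← fderiv_eq_sum_pd, h3]
  rfl

lemma differentiableAt : DifferentiableAt ℝ D.F D.x :=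
  (D.contDiffAt.eventually_differentiableAt (by omega)).self_of_nhds

lemma norm_pd_le (a : Fin m) (γ : Fin n) : ‖pd a (fun y => D.F y γ) D.x‖ ≤ 2 := by
  rw [pd_apply_eq D.differentiableAt]
  calc _ ≤ ‖fderiv ℝ D.F D.x (EuclideanSpace.single a 1)‖ := PiLp.norm_apply_le _ γ
    _ ≤ 2 * ‖(EuclideanSpace.single a 1 : Euc m)‖ :=
      ContinuousLinearMap.le_of_opNorm_le _ D.norm_fderiv_le _
    _ = 2 := by simp

lemma norm_ℓ_apply_le (c : Fin m) (γ : Fin n) : ‖D.ℓ (EuclideanSpace.single γ 1) c‖ ≤ 1 := by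
  calc _ ≤ ‖D.ℓ (EuclideanSpace.single γ 1)‖ := PiLp.norm_apply_le _ c
    _ ≤ 1 * ‖(EuclideanSpace.single γ 1 : Euc n)‖ :=
      ContinuousLinearMap.le_of_opNorm_le _ D.norm_ℓ_le _
    _ = 1 := by simp

lemma sum_ℓ_mul : ∀ᶠ y in 𝓝 D.x, ∀ c, ∑ γ, D.ℓ (EuclideanSpace.single γ 1) c * D.F y γ = y c := by
  filter_upwards [D.ℓ_comp] with y hy c
  conv_rhs => rw [← hy]
  have : D.F y = ∑ γ, D.F y γ • (EuclideanSpace.single γ (1 : ℝ) : Euc n) := by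
    ext b
    simp [Finset.sum_apply, Pi.single_apply]
  conv_rhs => rw [this]
  simp [Finset.sum_apply, mul_comm]

lemma norm_G_zero_le : ‖toEuclideanCLM (𝕜 := ℝ) (D.G (D.F D.x))‖ ≤ Γ := by
  simpa using D.norm_G_le 0 (Nat.zero_le _)

lemma norm_inv_G_zero_le : ‖toEuclideanCLM (𝕜 := ℝ) (D.G (D.F D.x))⁻¹‖ ≤ Γ := by
  simpa using D.norm_inv_G_le 0 (Nat.zero_le _)

lemma h_diag_le (hΓ : 0 < Γ) (a : Fin m) : D.h D.x a a ≤ Γ * 4 := by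
  rw [D.h_eq.self_of_nhds a a]
  simp only [pd_apply_eq D.differentiableAt]
  refine (quadratic_le_of_norm_le D.norm_G_zero_le _).trans ?_
  have : ‖fderiv ℝ D.F D.x (EuclideanSpace.single a 1)‖ ≤ 2 * ‖(EuclideanSpace.single a 1 : Euc m)‖ :=
    ContinuousLinearMap.le_of_opNorm_le _ D.norm_fderiv_le _
  have h1 : ‖(EuclideanSpace.single a 1 : Euc m)‖ = 1 := by simp
  rw [h1, mul_one] at this
  gcongr
  nlinarith [norm_nonneg (fderiv ℝ D.F D.x (EuclideanSpace.single a 1))]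

/-- The induced metric is `Jᵀ G J` with `G` positive definite, and the Jacobian `J` is injective
because `ℓ` is a left inverse of it. -/
lemma det_h_ne_zero : (D.h D.x).det ≠ 0 := by
  let J : Matrix (Fin n) (Fin m) ℝ := Matrix.of fun α a => pd a (fun z => D.F z α) D.x
  have hJ : D.h D.x = Jᴴ * D.G (D.F D.x) * J := by
    ext a b
    rw [D.h_eq.self_of_nhds a b, Finset.sum_comm]
    simp only [Matrix.mul_apply, conjTranspose_apply, J, Matrix.of_apply, star_trivial,
      Finset.sum_mul]
    exact Finset.sum_congr rfl fun γ _ => Finset.sum_congr rfl fun δ _ => by ring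
  have hinj : Function.Injective J.mulVec := by
    have hid : ∀ v : Euc m, D.ℓ (fderiv ℝ D.F D.x v) = v := by
      have h1 : HasFDerivAt (fun y => D.ℓ (D.F y)) (D.ℓ.comp (fderiv ℝ D.F D.x)) D.x :=
        D.ℓ.hasFDerivAt.comp D.x D.differentiableAt.hasFDerivAt
      have h2 : HasFDerivAt (fun y => D.ℓ (D.F y)) (ContinuousLinearMap.id ℝ (Euc m)) D.x :=
        (hasFDerivAt_id D.x).congr_of_eventuallyEq D.ℓ_comp
      intro v
      exact congrArg (fun L : Euc m →L[ℝ] Euc m => L v) (h1.unique h2)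
    have hmul : ∀ v : Fin m → ℝ, J.mulVec v = (fderiv ℝ D.F D.x (WithLp.toLp 2 v)).ofLp := by
      intro v
      ext α
      rw [fderiv_apply_component D.differentiableAt]
      simp only [mulVec, dotProduct, J, Matrix.of_apply]
      exact Finset.sum_congr rfl fun _ _ => mul_comm _ _
    intro v w hvw
    simp only [hmul] at hvw
    have h3 := congrArg D.ℓ (WithLp.ofLp_injective 2 hvw)
    rw [hid, hid] at h3
    exact (WithLp.toLp_injective 2) h3
  have := (D.posDef.conjTranspose_mul_mul_same hinj).det_pos
  rw [hJ]
  exact this.ne'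

lemma contDiffAt_h (a b : Fin m) : ContDiffAt ℝ (N + 1 : ℕ) (fun y => D.h y a b) D.x := by
  have h1 : ContDiffAt ℝ (N + 1 : ℕ) (fun y => ∑ α, ∑ β, D.G (D.F y) α β
    * pd a (fun z => D.F z α) y * pd b (fun z => D.F z β) y) D.x := by
    refine ContDiffAt.sum fun α _ => ContDiffAt.sum fun β _ => (ContDiffAt.mul ?_ ?_).mul ?_
    · exact (D.contDiffAt_G α β).comp D.x (D.contDiffAt.of_le (by exact_mod_cast (by omega)))
    · exact (contDiffAt_component D.contDiffAt α).pd a (by omega)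
    · exact (contDiffAt_component D.contDiffAt β).pd b (by omega)
  exact h1.congr_of_eventuallyEq (D.h_eq.mono fun y hy => hy a b)

/-- The derivatives of order `2, …, N + 2` of the germs are bounded. -/
theorem exists_norm_iteratedFDeriv_le (m n N : ℕ) {Γ B : ℝ} (hΓ : 0 < Γ) (hB : 0 ≤ B) :
    ∃ C : ℝ, 0 < C ∧ ∀ (D : GraphGerm m n N Γ B) (j : ℕ), 2 ≤ j → j ≤ N + 2 →
      ‖iteratedFDeriv ℝ j D.F D.x‖ ≤ C := by
  -- The family is indexed by all germs at once, so a bound uniform in the index is a constant that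
  -- depends only on `m`, `n`, `N`, `Γ`, `B`.
  let ι := GraphGerm m n N Γ B
  have hG : JetBounded (fun D : ι => D.F D.x) (N + 1)
      (fun D y => toEuclideanCLM (𝕜 := ℝ) (D.G y)) :=
    ⟨fun D => contDiffAt_toEuclideanCLM D.contDiffAt_G, Γ, fun D => D.norm_G_le⟩
  have hG' : JetBounded (fun D : ι => D.F D.x) (N + 1)
      (fun D y => toEuclideanCLM (𝕜 := ℝ) (D.G y)⁻¹) :=
    ⟨fun D => contDiffAt_toEuclideanCLM
      (contDiffAt_inv_apply D.contDiffAt_G D.posDef.det_pos.ne'), Γ, fun D => D.norm_inv_G_le⟩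
  have key := jetBounded_pd_of_higherForm (ι := ι) (x := fun D => D.x) (F := fun D => D.F)
    (G := fun D => D.G) (h := fun D => D.h)
    (ℓ := fun D c γ => D.ℓ (EuclideanSpace.single γ 1) c) (fun D => D.contDiffAt)
    (fun a γ => ⟨2, fun D => D.norm_pd_le a γ⟩) (fun γ α β => hG.christoffel hG' γ α β)
    (fun D => contDiffAt_christoffel D.contDiffAt_h D.det_h_ne_zero)
    (fun c γ => ⟨1, fun D => D.norm_ℓ_apply_le c γ⟩) (fun D => D.sum_ℓ_mul)
    -- `Γ * 4` bounds the diagonal of the induced metric, as `‖∂_a F‖ ≤ 2`; the form of index `j`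
    -- has `j + 2` arguments.
    (fun j hj I γ => ⟨√Γ * B * √(Γ * 4) ^ (j + 2), fun D =>
      component_le_of_tensorNorm_le hΓ hB (by positivity) D.posDef D.norm_inv_G_zero_le
        (D.h_diag_le hΓ) (D.tensorNorm_le j hj) I γ⟩)
  have h1 : JetBounded (fun D : ι => D.x) (N + 1) (fun D => fderiv ℝ D.F) := by
    have h2 : JetBounded (fun D : ι => D.x) (N + 1) (fun D y => ∑ a, ∑ γ,
        ContinuousLinearMap.toSpanSingleton ℝ ((EuclideanSpace.proj a : Euc m →L[ℝ] ℝ).smulRight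
          (EuclideanSpace.single γ (1 : ℝ) : Euc n)) (pd a (fun z => D.F z γ) y)) :=
      .sum fun a _ => .sum fun γ _ => (key a γ).clm (fun _ => le_rfl)
    refine h2.congr fun D => ?_
    filter_upwards [D.contDiffAt.eventually_differentiableAt (by omega)] with y hy
    ext v δ
    rw [fderiv_apply_component hy]
    simp [Finset.sum_apply, Pi.single_apply, mul_comm]
  obtain ⟨-, C, hC⟩ := h1
  refine ⟨max C 1, by positivity, fun D j h2 hj => ?_⟩
  obtain ⟨j, rfl⟩ : ∃ i, j = i + 1 := ⟨j - 1, by omega⟩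
  rw [← norm_iteratedFDeriv_fderiv]
  exact (hC D j (by omega)).trans (le_max_left _ _)

end GraphGerm

end Estimate

/-! ### Metrics in charts -/

section ChartMetric

lemma inner_linearMap_eq_sum {d : ℕ} {V : Type*} [NormedAddCommGroup V] [InnerProductSpace ℝ V]
    (L : Euc d →ₗ[ℝ] V) (v w : Euc d) :
    inner ℝ (L v) (L w) = ∑ a, ∑ b, inner ℝ (L (EuclideanSpace.single a (1 : ℝ)))
      (L (EuclideanSpace.single b (1 : ℝ))) * v a * w b := by
  have h : ∀ v : Euc d, L v = ∑ a, v a • L (EuclideanSpace.single a (1 : ℝ)) := by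
    intro v
    have hv : v = ∑ a, v a • (EuclideanSpace.single a (1 : ℝ) : Euc d) := by
      ext b
      simp [Finset.sum_apply, Pi.single_apply]
    conv_lhs => rw [hv]
    simp
  rw [h v, h w, sum_inner]
  refine Finset.sum_congr rfl fun a _ => ?_
  rw [inner_sum]
  refine Finset.sum_congr rfl fun b _ => ?_
  rw [inner_smul_left, inner_smul_right]
  simp only [conj_trivial]
  ring

lemma posDef_of_injective {d : ℕ} {V : Type*} [NormedAddCommGroup V] [InnerProductSpace ℝ V]
    (L : Euc d →ₗ[ℝ] V) (hL : Function.Injective L) :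
    (Matrix.of fun a b => inner ℝ (L (EuclideanSpace.single a (1 : ℝ)))
      (L (EuclideanSpace.single b (1 : ℝ)))).PosDef := by
  refine Matrix.PosDef.of_dotProduct_mulVec_pos ?_ fun x hx => ?_
  · ext a b
    simp [real_inner_comm]
  · have h1 := inner_linearMap_eq_sum L (WithLp.toLp 2 x) (WithLp.toLp 2 x)
    have h2 : star x ⬝ᵥ Matrix.mulVec (Matrix.of fun a b =>
        inner ℝ (L (EuclideanSpace.single a (1 : ℝ))) (L (EuclideanSpace.single b (1 : ℝ)))) x
        = inner ℝ (L (WithLp.toLp 2 x)) (L (WithLp.toLp 2 x)) := by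
      rw [h1]
      simp only [dotProduct, Matrix.mulVec, Matrix.of_apply, Finset.mul_sum, star_trivial]
      exact Finset.sum_congr rfl fun γ _ => Finset.sum_congr rfl fun δ _ => by ring
    rw [h2, real_inner_self_eq_norm_sq]
    have : L (WithLp.toLp 2 x) ≠ 0 := by
      rw [Ne, map_eq_zero_iff L hL]
      simpa using hx
    positivity

variable {d : ℕ} {X : Type*} [TopologicalSpace X] [ChartedSpace (Euc d) X]

lemma mdifferentiable_of_mem_maximalAtlas {φ : OpenPartialHomeomorph X (Euc d)} {k : ℕ} (hk : 1 ≤ k)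
    (hφ : φ ∈ IsManifold.maximalAtlas (𝓡 d) (k : WithTop ℕ∞) X) :
    φ.MDifferentiable (𝓡 d) (𝓡 d) := by
  have hk' : (k : WithTop ℕ∞) ≠ 0 := by exact_mod_cast (by omega : k ≠ 0)
  exact ⟨(contMDiffOn_of_mem_maximalAtlas hφ).mdifferentiableOn hk',
    (contMDiffOn_symm_of_mem_maximalAtlas hφ).mdifferentiableOn hk'⟩

variable [RiemannianBundle (fun x : X => TangentSpace (𝓡 d) x)]

lemma inner_mfderiv_symm (φ : OpenPartialHomeomorph X (Euc d)) (y v w : Euc d) :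
    inner ℝ (mfderiv (𝓡 d) (𝓡 d) φ.symm y v) (mfderiv (𝓡 d) (𝓡 d) φ.symm y w)
      = ∑ a, ∑ b, metricMatrix φ y a b * v a * w b :=
  inner_linearMap_eq_sum (V := TangentSpace (𝓡 d) (φ.symm y))
    (mfderiv (𝓡 d) (𝓡 d) φ.symm y).toLinearMap v w

lemma posDef_metricMatrix {φ : OpenPartialHomeomorph X (Euc d)} {y : Euc d}
    (hφ : φ.MDifferentiable (𝓡 d) (𝓡 d)) (hy : y ∈ φ.target) : (metricMatrix φ y).PosDef :=
  posDef_of_injective (V := TangentSpace (𝓡 d) (φ.symm y))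
    (mfderiv (𝓡 d) (𝓡 d) φ.symm y).toLinearMap (hφ.symm.mfderiv_injective hy)

/-- The coordinate vector fields come from the tangent map of a `C^{k+1}` inverse chart, hence are
`C^k` sections; pairing them with a `C^k` metric loses no further derivative. -/
lemma contDiffAt_metricMatrix [IsManifold (𝓡 d) 1 X] {k : ℕ} [hX : IsManifold (𝓡 d) ((k + 1 : ℕ) : WithTop ℕ∞) X]
    [IsContMDiffRiemannianBundle (𝓡 d) (k : WithTop ℕ∞) (Euc d)
      (fun x : X => TangentSpace (𝓡 d) x)]
    {φ : OpenPartialHomeomorph X (Euc d)}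
    (hφ : φ ∈ IsManifold.maximalAtlas (𝓡 d) ((k + 1 : ℕ) : WithTop ℕ∞) X)
    {y : Euc d} (hy : y ∈ φ.target) (a b : Fin d) :
    ContDiffAt ℝ k (fun z => metricMatrix φ z a b) y := by
  have : IsManifold (𝓡 d) ((k : WithTop ℕ∞) + 1) X := by exact_mod_cast hX
  have hb : ContMDiffVectorBundle (k : WithTop ℕ∞) (Euc d) (TangentSpace (𝓡 d) : X → Type _) (𝓡 d) :=
    TangentBundle.contMDiffVectorBundle
  have hsec : ∀ a : Fin d, ContMDiffOn (𝓡 d) ((𝓡 d).prod (𝓡 d)) (k : WithTop ℕ∞)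
      (fun z => (⟨φ.symm z, mfderiv (𝓡 d) (𝓡 d) φ.symm z (EuclideanSpace.single a (1 : ℝ) : Euc d)⟩ :
        TangentBundle (𝓡 d) X)) φ.target := by
    intro a
    have h1 := (contMDiffOn_symm_of_mem_maximalAtlas hφ).contMDiffOn_tangentMapWithin
      (m := (k : WithTop ℕ∞)) (by norm_cast) φ.open_target.uniqueMDiffOn
    have h2 : ContMDiff (𝓡 d) ((𝓡 d).prod (𝓡 d)) (k : WithTop ℕ∞)
        (fun z : Euc d => (⟨z, (EuclideanSpace.single a (1 : ℝ) : Euc d)⟩ :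
          TangentBundle (𝓡 d) (Euc d))) :=
      contMDiff_vectorSpace_iff_contDiff.2 contDiff_const
    refine (h1.comp h2.contMDiffOn (s := φ.target) fun z hz => hz).congr fun z hz => ?_
    simp only [tangentMapWithin, Function.comp, mfderivWithin_of_isOpen φ.open_target hz]
  have := ((hsec a).inner_bundle (hsec b))
  exact (this.contMDiffAt (φ.open_target.mem_nhds hy)).contDiffAt

end ChartMetric

/-! ### Adapted rotations -/

section Coordinates

variable {m n : ℕ}

/-- The projection of `ℝ^n` to its first `m` coordinates. -/
def headCoords (hmn : m ≤ n) : Euc n →L[ℝ] Euc m :=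
  LinearMap.toContinuousLinearMap
    { toFun := fun z => WithLp.toLp 2 fun a => z (Fin.castLE hmn a)
      map_add' := fun _ _ => rfl
      map_smul' := fun _ _ => rfl }

/-- The projection of `ℝ^n` to its last `n - m` coordinates. -/
def tailCoords (m n : ℕ) : Euc n →L[ℝ] Euc (n - m) :=
  LinearMap.toContinuousLinearMap
    { toFun := fun z => WithLp.toLp 2 fun b => z ⟨m + b, by omega⟩
      map_add' := fun _ _ => rfl
      map_smul' := fun _ _ => rfl }

@[simp] lemma headCoords_apply (hmn : m ≤ n) (z : Euc n) (a : Fin m) :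
    headCoords hmn z a = z (Fin.castLE hmn a) := rfl

@[simp] lemma tailCoords_apply (z : Euc n) (b : Fin (n - m)) :
    tailCoords m n z b = z ⟨m + b, by omega⟩ := rfl

lemma joinCoords_head_tail (hmn : m ≤ n) (z : Euc n) :
    joinCoords (headCoords hmn z) (tailCoords m n z) = z := by
  ext a
  simp only [joinCoords]
  split_ifs with h
  · simp
  · simp only [tailCoords_apply]
    refine congrArg z.ofLp (Fin.ext ?_)
    simp only
    omega

lemma norm_sq_eq_head_add_tail (hmn : m ≤ n) (z : Euc n) :
    ‖z‖ ^ 2 = ‖headCoords hmn z‖ ^ 2 + ‖tailCoords m n z‖ ^ 2 := by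
  obtain ⟨l, hl⟩ : ∃ l, l = n - m := ⟨_, rfl⟩
  simp only [EuclideanSpace.real_norm_sq_eq, headCoords_apply, tailCoords_apply]
  have e : m + (n - m) = n := by omega
  rw [← Equiv.sum_comp (finCongr e) (fun a => z a ^ 2), Fin.sum_univ_add]
  rfl

/-- An orthonormal basis of the range of `L` is completed to one of `ℝ^n`, whose coordinates give
the isometry. The orientation may force some signs to change; this does not affect orthogonality to
the range. -/
lemma exists_rotation_adapted (hm : 1 ≤ m) (hmn : m ≤ n) (L : Euc m →ₗ[ℝ] Euc n)
    (hL : Function.Injective L) :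
    ∃ A : Euc n ≃ₗᵢ[ℝ] Euc n, LinearMap.det (A.toLinearEquiv : Euc n →ₗ[ℝ] Euc n) = 1 ∧
      ∀ v, tailCoords m n (A.symm (L v)) = 0 := by
  have hne : Nonempty (Fin n) := ⟨⟨0, by omega⟩⟩
  have hrank : Module.finrank ℝ (LinearMap.range L) = m := by
    rw [LinearMap.finrank_range_of_inj hL]; simp
  let w : OrthonormalBasis (Fin m) ℝ (LinearMap.range L) :=
    (stdOrthonormalBasis ℝ (LinearMap.range L)).reindex (finCongr hrank)
  let v : Fin n → Euc n := fun a => if h : (a : ℕ) < m then (w ⟨a, h⟩ : Euc n) else 0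
  let s : Set (Fin n) := {a | (a : ℕ) < m}
  have hv : Orthonormal ℝ (s.domRestrict v) := by
    have h1 : Orthonormal ℝ (fun a : Fin m => (w a : Euc n)) :=
      w.orthonormal.comp_linearIsometry (LinearMap.range L).subtypeₗᵢ
    have h2 := h1.comp (fun a : s => (⟨a.1, a.2⟩ : Fin m)) (fun a b hab => by
      apply Subtype.ext; apply Fin.ext; simpa using hab)
    convert h2 using 1
    ext1 a
    have : ((a : Fin n) : ℕ) < m := a.2
    simp [v, this]
  obtain ⟨b, hb⟩ := hv.exists_orthonormalBasis_extension_of_card_eq (by simp)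
  let std : OrthonormalBasis (Fin n) ℝ (Euc n) := EuclideanSpace.basisFun (Fin n) ℝ
  let b' := b.adjustToOrientation std.toBasis.orientation
  refine ⟨b'.repr.symm, ?_, fun u => ?_⟩
  · have h1 : std.toBasis.det b' = 1 :=
      std.det_to_matrix_orthonormalBasis_of_same_orientation b'
        (b.orientation_adjustToOrientation _).symm
    have h2 := std.toBasis.det_comp (b'.repr.symm.toLinearEquiv : Euc n →ₗ[ℝ] Euc n) std.toBasis
    have h3 : (b'.repr.symm.toLinearEquiv : Euc n →ₗ[ℝ] Euc n) ∘ std.toBasis = b' := by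
      ext1 a
      simp [std]
    rw [h3, h1, Module.Basis.det_self, mul_one] at h2
    exact h2.symm
  · ext j
    simp only [LinearIsometryEquiv.symm_symm, tailCoords_apply, PiLp.zero_apply]
    rw [b'.repr_apply_apply]
    have hu : L u ∈ LinearMap.range L := LinearMap.mem_range_self L u
    have h1 : L u = ∑ a : Fin m, w.repr ⟨L u, hu⟩ a • (w a : Euc n) := by
      have h2 := congrArg Subtype.val (w.sum_repr ⟨L u, hu⟩)
      exact h2.symm.trans (by simp)
    have h2 : ∀ a : Fin m, inner ℝ (b ⟨m + j, by omega⟩) (w a : Euc n) = 0 := by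
      intro a
      have h3 := hb (Fin.castLE hmn a) (by simp [s])
      have h4 : v (Fin.castLE hmn a) = w a := by simp [v]
      rw [← h4, ← h3]
      refine b.orthonormal.2 fun h => ?_
      have := congrArg Fin.val h
      simp at this
      omega
    have h3 : inner ℝ (b ⟨m + j, by omega⟩) (L u) = 0 := by
      rw [h1, inner_sum]
      exact Finset.sum_eq_zero fun a _ => by rw [inner_smul_right, h2, mul_zero]
    rcases b.adjustToOrientation_apply_eq_or_eq_neg std.toBasis.orientation ⟨m + j, by omega⟩ with
      h | h
    · simp only [b', h, h3]
    · simp only [b', h, inner_neg_left, h3, neg_zero]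

end Coordinates

/-! ### Local graphs -/

section Steep

variable {m n l : ℕ}

/-- The image of `T` is the graph of a linear map of norm less than `1` over the range of `P`. -/
def IsGraphical (P : Euc n →L[ℝ] Euc m) (Q : Euc n →L[ℝ] Euc l) (T : Euc m →L[ℝ] Euc n) : Prop :=
  ∀ v, v ≠ 0 → ‖Q (T v)‖ < ‖P (T v)‖

variable {P : Euc n →L[ℝ] Euc m} {Q : Euc n →L[ℝ] Euc l} {T : Euc m →L[ℝ] Euc n}

lemma isGraphical_iff_sphere :
    IsGraphical P Q T ↔ ∀ v ∈ Metric.sphere (0 : Euc m) 1, ‖Q (T v)‖ < ‖P (T v)‖ := by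
  constructor
  · intro h v hv
    exact h v (Metric.ne_of_mem_sphere hv one_ne_zero)
  · intro h v hv
    have hv' : 0 < ‖v‖ := norm_pos_iff.2 hv
    have h1 := h (‖v‖⁻¹ • v) (by simp [norm_smul, hv'.ne'])
    simp only [map_smul, norm_smul, norm_inv, norm_norm] at h1
    exact (mul_lt_mul_iff_right₀ (inv_pos.2 hv')).1 h1

/-- The strict inequality only has to be tested on the unit sphere, whose compactness makes it
stable under small changes of `T`. -/
lemma isOpen_isGraphical (P : Euc n →L[ℝ] Euc m) (Q : Euc n →L[ℝ] Euc l) :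
    IsOpen {T : Euc m →L[ℝ] Euc n | IsGraphical P Q T} := by
  refine isOpen_iff_mem_nhds.2 fun T hT => ?_
  simp only [mem_ofPred_eq, isGraphical_iff_sphere] at hT
  have := (isCompact_sphere (0 : Euc m) 1).eventually_forall_of_forall_eventually (x₀ := T)
    (P := fun T v => ‖Q (T v)‖ < ‖P (T v)‖) fun v hv => by
      have h1 : ContinuousAt (fun z : (Euc m →L[ℝ] Euc n) × Euc m => ‖Q (z.1 z.2)‖) (T, v) := by
        fun_prop
      have h2 : ContinuousAt (fun z : (Euc m →L[ℝ] Euc n) × Euc m => ‖P (z.1 z.2)‖) (T, v) := by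
        fun_prop
      exact h1.eventually_lt h2 (hT v hv)
  filter_upwards [this] with T' hT'
  exact isGraphical_iff_sphere.2 hT'

lemma IsGraphical.injective (h : IsGraphical P Q T) : Function.Injective (P.comp T) := by
  rw [injective_iff_map_eq_zero]
  intro v hv
  by_contra hne
  have := h v hne
  rw [ContinuousLinearMap.comp_apply] at hv
  rw [hv, norm_zero] at this
  exact absurd this (not_lt.2 (norm_nonneg _))

/-- The condition depends only on the image of `T`, hence not on the chart of the submanifold. -/
lemma isGraphical_comp_iff {L : Euc m →L[ℝ] Euc m} (hL : Function.Bijective L) :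
    IsGraphical P Q (T.comp L) ↔ IsGraphical P Q T := by
  constructor
  · intro h v hv
    obtain ⟨w, rfl⟩ := hL.2 v
    exact h w fun hw => hv (by rw [hw, map_zero])
  · intro h v hv
    exact h (L v) fun hw => hv (hL.1 (by rw [hw, map_zero]))

end Steep

section Region

variable {m n l : ℕ} {S : Type*} [TopologicalSpace S] [ChartedSpace (Euc m) S]

/-- The differential of a map to `ℝ^n`, as a linear map on the model space. -/
def modelDeriv (Φ : S → Euc n) (q : S) : Euc m →L[ℝ] Euc n := mfderiv (𝓡 m) (𝓡 n) Φ q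

/-- The points of `N` at which the image of `Φ` is infinitesimally a graph of slope less than `1`. -/
def graphRegion (Φ : S → Euc n) (N : Set S) (P : Euc n →L[ℝ] Euc m) (Q : Euc n →L[ℝ] Euc l) :
    Set S :=
  {q ∈ N | IsGraphical P Q (modelDeriv (m := m) Φ q)}

variable {Φ : S → Euc n} {N : Set S} {P : Euc n →L[ℝ] Euc m} {Q : Euc n →L[ℝ] Euc l} {k : ℕ}

lemma fderiv_comp_chart_symm {ψ : OpenPartialHomeomorph S (Euc m)}
    (hψ : ψ.MDifferentiable (𝓡 m) (𝓡 m)) {y : Euc m} (hy : y ∈ ψ.target)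
    (hΦ : MDifferentiableAt (𝓡 m) (𝓡 n) Φ (ψ.symm y)) (v : Euc m) :
    fderiv ℝ (Φ ∘ ψ.symm) y v
      = modelDeriv (m := m) Φ (ψ.symm y) (mfderiv (𝓡 m) (𝓡 m) ψ.symm y v) := by
  have h1 := mfderiv_comp_apply y hΦ (hψ.mdifferentiableAt_symm hy) v
  rw [mfderiv_eq_fderiv] at h1
  exact h1

lemma isGraphical_fderiv_iff {ψ : OpenPartialHomeomorph S (Euc m)}
    (hψ : ψ.MDifferentiable (𝓡 m) (𝓡 m)) {y : Euc m} (hy : y ∈ ψ.target)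
    (hΦ : MDifferentiableAt (𝓡 m) (𝓡 n) Φ (ψ.symm y)) :
    IsGraphical P Q (fderiv ℝ (Φ ∘ ψ.symm) y) ↔
      IsGraphical P Q (modelDeriv (m := m) Φ (ψ.symm y)) := by
  let L : Euc m →L[ℝ] Euc m := mfderiv (𝓡 m) (𝓡 m) ψ.symm y
  have hL : Function.Bijective L := hψ.symm.mfderiv_bijective hy
  let T : Euc m →L[ℝ] Euc n := modelDeriv (m := m) Φ (ψ.symm y)
  have h1 : fderiv ℝ (Φ ∘ ψ.symm) y = T.comp L :=
    ContinuousLinearMap.ext (fderiv_comp_chart_symm hψ hy hΦ)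
  rw [h1]
  exact isGraphical_comp_iff hL

variable [IsManifold (𝓡 m) (k : WithTop ℕ∞) S]

lemma mdifferentiable_chartAt (hk : 1 ≤ k) (q : S) :
    (chartAt (Euc m) q).MDifferentiable (𝓡 m) (𝓡 m) :=
  mdifferentiable_of_mem_maximalAtlas hk (IsManifold.chart_mem_maximalAtlas (n := (k : WithTop ℕ∞)) q)

lemma contDiffAt_comp_chartAt_symm (hN : IsOpen N)
    (hΦ : ContMDiffOn (𝓡 m) (𝓡 n) (k : WithTop ℕ∞) Φ N) (q₀ : S) {y : Euc m}
    (hy : y ∈ (chartAt (Euc m) q₀).target) (hyN : (chartAt (Euc m) q₀).symm y ∈ N) :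
    ContDiffAt ℝ k (Φ ∘ (chartAt (Euc m) q₀).symm) y := by
  have h1 : ContMDiffAt (𝓡 m) (𝓡 m) (k : WithTop ℕ∞) (chartAt (Euc m) q₀).symm y :=
    contMDiffAt_symm_of_mem_maximalAtlas (IsManifold.chart_mem_maximalAtlas q₀) hy
  exact ((hΦ.contMDiffAt (hN.mem_nhds hyN)).comp y h1).contDiffAt

lemma isOpen_graphRegion (hk : 1 ≤ k) (hN : IsOpen N)
    (hΦ : ContMDiffOn (𝓡 m) (𝓡 n) (k : WithTop ℕ∞) Φ N) : IsOpen (graphRegion Φ N P Q) := by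
  refine isOpen_iff_mem_nhds.2 fun q hq => ?_
  set ψ := chartAt (Euc m) q with hψ
  have hψd : ψ.MDifferentiable (𝓡 m) (𝓡 m) := mdifferentiable_chartAt (k := k) hk q
  have hqs : q ∈ ψ.source := mem_chart_source _ q
  have hmd : ∀ q' ∈ N, MDifferentiableAt (𝓡 m) (𝓡 n) Φ q' := fun q' hq' =>
    (hΦ.contMDiffAt (hN.mem_nhds hq')).mdifferentiableAt (by exact_mod_cast (by omega : k ≠ 0))
  have hc : ContinuousAt (fderiv ℝ (Φ ∘ ψ.symm)) (ψ q) := by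
    have h1 := contDiffAt_comp_chartAt_symm hN hΦ q (y := ψ q) (ψ.map_source hqs)
      (by rw [ψ.left_inv hqs]; exact hq.1)
    have h2 : ContDiffAt ℝ (0 : ℕ) (fderiv ℝ (Φ ∘ ψ.symm)) (ψ q) :=
      h1.fderiv_right (by exact_mod_cast hk)
    exact h2.continuousAt
  have hg : IsGraphical P Q (fderiv ℝ (Φ ∘ ψ.symm) (ψ q)) := by
    rw [isGraphical_fderiv_iff hψd (ψ.map_source hqs), ψ.left_inv hqs]
    · exact hq.2
    · rw [ψ.left_inv hqs]; exact hmd q hq.1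
  have h3 := (ψ.continuousAt hqs).eventually
    (hc.eventually ((isOpen_isGraphical P Q).mem_nhds hg))
  filter_upwards [h3, ψ.open_source.mem_nhds hqs, hN.mem_nhds hq.1] with q' h4 h5 h6
  refine ⟨h6, ?_⟩
  have h7 := (isGraphical_fderiv_iff (Φ := Φ) (P := P) (Q := Q) hψd (ψ.map_source h5)
    (by rw [ψ.left_inv h5]; exact hmd q' h6)).1 h4
  rwa [ψ.left_inv h5] at h7

/-- A slope bound of `1 / 2` is a closed condition and passes to the limit. Since the differential
is injective there, the `P`-part cannot vanish on a nonzero vector, so `1 / 2` yields the strict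
bound `1`. -/
lemma mem_graphRegion_of_tendsto (hk : 1 ≤ k) (hN : IsOpen N)
    (hΦ : ContMDiffOn (𝓡 m) (𝓡 n) (k : WithTop ℕ∞) Φ N)
    (hPQ : ∀ z : Euc n, ‖z‖ ^ 2 = ‖P z‖ ^ 2 + ‖Q z‖ ^ 2) {q : S} (hq : q ∈ N)
    (hinj : Function.Injective (modelDeriv (m := m) Φ q)) {X : Type*} {f : Filter X} [f.NeBot]
    {α : X → S} (hα : Filter.Tendsto α f (𝓝 q))
    (hslope : ∀ᶠ x in f, ∀ v, ‖Q (modelDeriv (m := m) Φ (α x) v)‖ ≤ 1 / 2 * ‖P (modelDeriv (m := m) Φ (α x) v)‖) :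
    q ∈ graphRegion Φ N P Q := by
  set ψ := chartAt (Euc m) q with hψ
  have hψd : ψ.MDifferentiable (𝓡 m) (𝓡 m) := mdifferentiable_chartAt (k := k) hk q
  have hqs : q ∈ ψ.source := mem_chart_source _ q
  have hmd : ∀ q' ∈ N, MDifferentiableAt (𝓡 m) (𝓡 n) Φ q' := fun q' hq' =>
    (hΦ.contMDiffAt (hN.mem_nhds hq')).mdifferentiableAt (by exact_mod_cast (by omega : k ≠ 0))
  have hc : ContinuousAt (fderiv ℝ (Φ ∘ ψ.symm)) (ψ q) := by
    have h1 := contDiffAt_comp_chartAt_symm hN hΦ q (y := ψ q) (ψ.map_source hqs)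
      (by rw [ψ.left_inv hqs]; exact hq)
    have h2 : ContDiffAt ℝ (0 : ℕ) (fderiv ℝ (Φ ∘ ψ.symm)) (ψ q) :=
      h1.fderiv_right (by exact_mod_cast hk)
    exact h2.continuousAt
  have hT : Filter.Tendsto (fun x => fderiv ℝ (Φ ∘ ψ.symm) (ψ (α x))) f
      (𝓝 (fderiv ℝ (Φ ∘ ψ.symm) (ψ q))) :=
    hc.tendsto.comp ((ψ.continuousAt hqs).tendsto.comp hα)
  have hder : ∀ q' ∈ ψ.source, q' ∈ N → ∀ v, fderiv ℝ (Φ ∘ ψ.symm) (ψ q') v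
      = modelDeriv (m := m) Φ q' (mfderiv (𝓡 m) (𝓡 m) ψ.symm (ψ q') v) := by
    intro q' h1 h2 v
    have h3 := fderiv_comp_chart_symm (Φ := Φ) hψd (ψ.map_source h1)
      (by rw [ψ.left_inv h1]; exact hmd q' h2) v
    rwa [ψ.left_inv h1] at h3
  have hlim : ∀ v, ‖Q (fderiv ℝ (Φ ∘ ψ.symm) (ψ q) v)‖
      ≤ 1 / 2 * ‖P (fderiv ℝ (Φ ∘ ψ.symm) (ψ q) v)‖ := by
    intro v
    have h1 := ((ContinuousLinearMap.apply ℝ (Euc n) v).continuous.tendsto _).comp hT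
    refine le_of_tendsto_of_tendsto ((Q.continuous.tendsto _).comp h1).norm
      (((P.continuous.tendsto _).comp h1).norm.const_mul (1 / 2)) ?_
    filter_upwards [hslope, hα.eventually (ψ.open_source.mem_nhds hqs),
      hα.eventually (hN.mem_nhds hq)] with x h2 h3 h4
    have h5 := h2 (mfderiv (𝓡 m) (𝓡 m) ψ.symm (ψ (α x)) v)
    rw [← hder _ h3 h4] at h5
    exact h5
  let L : Euc m →L[ℝ] Euc m := mfderiv (𝓡 m) (𝓡 m) ψ.symm (ψ q)
  have hL : Function.Bijective L := hψd.symm.mfderiv_bijective (ψ.map_source hqs)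
  have hder' : ∀ w, fderiv ℝ (Φ ∘ ψ.symm) (ψ q) w = modelDeriv (m := m) Φ q (L w) :=
    hder q hqs hq
  refine ⟨hq, fun v hv => ?_⟩
  obtain ⟨w, hw⟩ := hL.2 v
  have h1 := hlim w
  rw [hder' w, hw] at h1
  have h2 : modelDeriv (m := m) Φ q v ≠ 0 := fun h => hv (hinj (h.trans (map_zero _).symm))
  have h3 : 0 < ‖modelDeriv (m := m) Φ q v‖ := norm_pos_iff.2 h2
  have h4 := hPQ (modelDeriv (m := m) Φ q v)
  have h5 : 0 < ‖P (modelDeriv (m := m) Φ q v)‖ := by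
    by_contra h
    have h6 : ‖P (modelDeriv (m := m) Φ q v)‖ = 0 := le_antisymm (not_lt.1 h) (norm_nonneg _)
    have h7 : ‖Q (modelDeriv (m := m) Φ q v)‖ = 0 :=
      le_antisymm (by rw [h6, mul_zero] at h1; exact h1) (norm_nonneg _)
    rw [h6, h7] at h4
    nlinarith
  linarith

/-- Inverse function theorem: slope less than `1` makes the derivative of `P ∘ Φ` injective, and it
is an endomorphism of `ℝ^m` in a chart. -/
lemma exists_localHomeo_of_mem_graphRegion (hk : 1 ≤ k) (hN : IsOpen N)
    (hΦ : ContMDiffOn (𝓡 m) (𝓡 n) (k : WithTop ℕ∞) Φ N) {q : S} (hq : q ∈ graphRegion Φ N P Q) :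
    ∃ e : OpenPartialHomeomorph S (Euc m), q ∈ e.source ∧ e.source ⊆ graphRegion Φ N P Q ∧
      EqOn e (fun q => P (Φ q)) e.source ∧
      ContMDiffAt (𝓡 m) (𝓡 m) (k : WithTop ℕ∞) e.symm (e q) := by
  set ψ := chartAt (Euc m) q with hψ
  have hψd : ψ.MDifferentiable (𝓡 m) (𝓡 m) := mdifferentiable_chartAt (k := k) hk q
  have hqs : q ∈ ψ.source := mem_chart_source _ q
  have hk0 : (k : WithTop ℕ∞) ≠ 0 := by exact_mod_cast (by omega : k ≠ 0)
  have hF := contDiffAt_comp_chartAt_symm hN hΦ q (y := ψ q) (ψ.map_source hqs)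
      (by rw [ψ.left_inv hqs]; exact hq.1)
  have hg : ContDiffAt ℝ k (fun y => P ((Φ ∘ ψ.symm) y)) (ψ q) := P.contDiff.contDiffAt.comp _ hF
  have hgr : IsGraphical P Q (fderiv ℝ (Φ ∘ ψ.symm) (ψ q)) := by
    rw [isGraphical_fderiv_iff hψd (ψ.map_source hqs), ψ.left_inv hqs]
    · exact hq.2
    · rw [ψ.left_inv hqs]
      exact (hΦ.contMDiffAt (hN.mem_nhds hq.1)).mdifferentiableAt hk0
  let L : Euc m ≃L[ℝ] Euc m := (LinearEquiv.ofInjectiveEndo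
    (P.comp (fderiv ℝ (Φ ∘ ψ.symm) (ψ q))).toLinearMap hgr.injective).toContinuousLinearEquiv
  have hL : HasFDerivAt (fun y => P ((Φ ∘ ψ.symm) y)) (L : Euc m →L[ℝ] Euc m) (ψ q) := by
    have h1 : HasFDerivAt (fun y => P ((Φ ∘ ψ.symm) y))
        (P.comp (fderiv ℝ (Φ ∘ ψ.symm) (ψ q))) (ψ q) :=
      P.hasFDerivAt.comp _ (hF.differentiableAt hk0).hasFDerivAt
    convert h1 using 1
    ext v
    rfl
  set e₀ := hg.toOpenPartialHomeomorph _ hL hk0 with he₀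
  have hopen := isOpen_graphRegion (P := P) (Q := Q) hk hN hΦ
  -- The restriction to the open region ensures that local inverses take values in it.
  set e := (ψ.trans e₀).restrOpen _ hopen with he
  have hqe : q ∈ e.source := by
    simp only [he, OpenPartialHomeomorph.restrOpen_source, OpenPartialHomeomorph.trans_source]
    exact ⟨⟨hqs, hg.mem_toOpenPartialHomeomorph_source hL hk0⟩, hq⟩
  refine ⟨e, hqe, ?_, ?_, ?_⟩
  · simp only [he, OpenPartialHomeomorph.restrOpen_source]
    exact inter_subset_right
  · intro q' hq'
    simp only [he, OpenPartialHomeomorph.restrOpen_source, OpenPartialHomeomorph.trans_source] at hq'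
    change P (Φ (ψ.symm (ψ q'))) = P (Φ q')
    rw [ψ.left_inv hq'.1.1]
  · have h1 : ContDiffAt ℝ k e₀.symm (e₀ (ψ q)) := hg.to_localInverse hL hk0
    have h2 : e₀.symm (e₀ (ψ q)) = ψ q :=
      e₀.left_inv (hg.mem_toOpenPartialHomeomorph_source hL hk0)
    have h3 : ContMDiffAt (𝓡 m) (𝓡 m) (k : WithTop ℕ∞) ψ.symm (ψ q) :=
      contMDiffAt_symm_of_mem_maximalAtlas (IsManifold.chart_mem_maximalAtlas q) (ψ.map_source hqs)
    have h4 : ContMDiffAt (𝓡 m) (𝓡 m) (k : WithTop ℕ∞) ψ.symm (e₀.symm (e₀ (ψ q))) := by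
      rw [h2]; exact h3
    exact h4.comp (e₀ (ψ q)) h1.contMDiffAt

lemma locallyHomeoOn_graphRegion (hk : 1 ≤ k) (hN : IsOpen N)
    (hΦ : ContMDiffOn (𝓡 m) (𝓡 n) (k : WithTop ℕ∞) Φ N) :
    LocallyHomeoOn (fun q => P (Φ q)) (graphRegion Φ N P Q) := fun q hq => by
  obtain ⟨e, h1, h2, h3, -⟩ := exists_localHomeo_of_mem_graphRegion (k := k) hk hN hΦ hq
  exact ⟨e, h1, h2, h3⟩

/-- Sections over open sets are inverses of charts. -/
lemma exists_chart_of_section (hk : 1 ≤ k) (hN : IsOpen N)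
    (hΦ : ContMDiffOn (𝓡 m) (𝓡 n) (k : WithTop ℕ∞) Φ N) {D : Set (Euc m)} (hD : IsOpen D) {p : S}
    {α : Euc m → S} (hα : IsSection (fun q => P (Φ q)) (graphRegion Φ N P Q) p D α) :
    ∃ ψ : OpenPartialHomeomorph S (Euc m), ψ ∈ IsManifold.maximalAtlas (𝓡 m) (k : WithTop ℕ∞) S ∧
      ψ.target = D ∧ (ψ.symm : Euc m → S) = α ∧ ψ.source ⊆ graphRegion Φ N P Q := by
  -- By continuity `α` stays in the source of a local inverse, so near `x` it coincides with that
  -- inverse and inherits its smoothness and openness.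
  have hloc : ∀ x ∈ D, ContMDiffAt (𝓡 m) (𝓡 m) (k : WithTop ℕ∞) α x ∧
      Filter.map α (𝓝 x) = 𝓝 (α x) := by
    intro x hx
    obtain ⟨e, h1, h2, h3, h4⟩ := exists_localHomeo_of_mem_graphRegion hk hN hΦ (hα.mem x hx)
    have h5 : e (α x) = x := (h3 h1).trans (hα.right_inv x hx)
    have hx' : x ∈ e.target := h5 ▸ e.map_source h1
    have hs : e.symm x = α x := by rw [← e.left_inv h1, h5]
    have h6 : α =ᶠ[𝓝 x] e.symm := by
      have hc : ContinuousAt α x := hα.continuousOn.continuousAt (hD.mem_nhds hx)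
      filter_upwards [hD.mem_nhds hx, hc.eventually (e.open_source.mem_nhds h1)] with y hy hy'
      rw [← e.left_inv hy', h3 hy']
      exact congrArg e.symm (hα.right_inv y hy)
    rw [h5] at h4
    refine ⟨h4.congr_of_eventuallyEq h6, ?_⟩
    rw [Filter.map_congr h6, ← hs]
    exact e.symm.map_nhds_eq hx'
  have hinj : InjOn α D := fun x hx y hy hxy => by
    rw [← hα.right_inv x hx, ← hα.right_inv y hy, hxy]
  have hopen : IsOpen (α '' D) := by
    refine isOpen_iff_mem_nhds.2 ?_
    rintro _ ⟨x, hx, rfl⟩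
    rw [← (hloc x hx).2]
    exact Filter.image_mem_map (hD.mem_nhds hx)
  have himg : α '' D ⊆ graphRegion Φ N P Q := by
    rintro _ ⟨x, hx, rfl⟩
    exact hα.mem x hx
  have hπ : ContMDiffOn (𝓡 m) (𝓡 m) (k : WithTop ℕ∞) (fun q => P (Φ q)) (α '' D) :=
    (P.contMDiff (n := (k : WithTop ℕ∞))).comp_contMDiffOn (hΦ.mono fun q hq => (himg hq).1)
  let ψ : OpenPartialHomeomorph S (Euc m) :=
    { toFun := fun q => P (Φ q)
      invFun := α
      source := α '' D
      target := D
      map_source' := by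
        rintro _ ⟨x, hx, rfl⟩
        simpa only [hα.right_inv x hx] using hx
      map_target' := fun x hx => mem_image_of_mem α hx
      left_inv' := by
        rintro _ ⟨x, hx, rfl⟩
        exact congrArg α (hα.right_inv x hx)
      right_inv' := fun x hx => hα.right_inv x hx
      open_source := hopen
      open_target := hD
      continuousOn_toFun := hπ.continuousOn
      continuousOn_invFun := hα.continuousOn }
  exact ⟨ψ, ψ.mem_maximalAtlas_of_contMDiffOn hπ fun x hx => (hloc x hx).1.contMDiffWithinAt,
    rfl, rfl, himg⟩

end Region

/-! ### Isometric immersions in charts -/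

lemma norm_iteratedFDeriv_le_of_ckNorm_le {E F : Type*} [NormedAddCommGroup E] [NormedSpace ℝ E]
    [NormedAddCommGroup F] [NormedSpace ℝ F] {k j : ℕ} {f : E → F} {Ω : Set E} {Γ : ℝ}
    (hΓ : 0 ≤ Γ) (h : ckNorm k f Ω ≤ ENNReal.ofReal Γ) (hj : j ≤ k) {x : E} (hx : x ∈ Ω) :
    ‖iteratedFDeriv ℝ j f x‖ ≤ Γ := by
  have h1 : ‖iteratedFDeriv ℝ j f x‖ₑ ≤ ENNReal.ofReal Γ := by
    calc ‖iteratedFDeriv ℝ j f x‖ₑ ≤ ⨆ x ∈ Ω, ‖iteratedFDeriv ℝ j f x‖ₑ :=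
          le_iSup₂ (f := fun x (_ : x ∈ Ω) => ‖iteratedFDeriv ℝ j f x‖ₑ) x hx
      _ ≤ ckNorm k f Ω := Finset.single_le_sum (f := fun j => ⨆ x ∈ Ω, ‖iteratedFDeriv ℝ j f x‖ₑ)
          (fun _ _ => zero_le) (Finset.mem_range.2 (by omega))
      _ ≤ _ := h
  rw [← ofReal_norm] at h1
  exact (ENNReal.ofReal_le_ofReal_iff hΓ).1 h1

section Immersion

variable {m n : ℕ} {S M : Type*} [TopologicalSpace S] [ChartedSpace (Euc m) S]
  [TopologicalSpace M] [ChartedSpace (Euc n) M]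
  [RiemannianBundle (fun x : M => TangentSpace (𝓡 n) x)]
  {k : ℕ} {i : S → M} {φ : OpenPartialHomeomorph M (Euc n)}

lemma inner_mfderiv_congr {i' : S → M} {q : S} (h : i' =ᶠ[𝓝 q] i) (v w : TangentSpace (𝓡 m) q) :
    inner ℝ (mfderiv (𝓡 m) (𝓡 n) i' q v) (mfderiv (𝓡 m) (𝓡 n) i' q w)
      = inner ℝ (mfderiv (𝓡 m) (𝓡 n) i q v) (mfderiv (𝓡 m) (𝓡 n) i q w) := by
  -- The two sides use the fibres over `i' q` and `i q`. As a function of the base point and two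
  -- model vectors, the metric can be compared at both.
  let g : M → Euc n → Euc n → ℝ := fun x a b =>
    @inner ℝ (TangentSpace (𝓡 n) x) _ a b
  let T' : Euc m →L[ℝ] Euc n := mfderiv (𝓡 m) (𝓡 n) i' q
  let T : Euc m →L[ℝ] Euc n := mfderiv (𝓡 m) (𝓡 n) i q
  have hT : T' = T := h.mfderiv_eq
  have hq : i' q = i q := h.self_of_nhds
  change g (i' q) (T' v) (T' w) = g (i q) (T v) (T w)
  rw [hT, hq]

variable [RiemannianBundle (fun x : S => TangentSpace (𝓡 m) x)]

/-- Near `q` the immersion equals `φ.symm ∘ (φ ∘ i)`; the chain rule expresses the induced metric by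
the matrix of the ambient one. -/
lemma inner_eq_sum_of_isometricImmersion (hi : IsIsometricImmersion (m := m) (n := n) k i)
    (hk : 1 ≤ k) (hφ : φ ∈ IsManifold.maximalAtlas (𝓡 n) (k : WithTop ℕ∞) M) {q : S}
    (hq : i q ∈ φ.source) (v w : TangentSpace (𝓡 m) q) :
    inner ℝ v w = ∑ a, ∑ b, metricMatrix φ (φ (i q)) a b
      * modelDeriv (m := m) (φ ∘ i) q v a
      * modelDeriv (m := m) (φ ∘ i) q w b := by
  have hk0 : (k : WithTop ℕ∞) ≠ 0 := by exact_mod_cast (by omega : k ≠ 0)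
  have hφd := mdifferentiable_of_mem_maximalAtlas hk hφ
  have h1 : φ.symm ∘ (φ ∘ i) =ᶠ[𝓝 q] i := by
    filter_upwards [hi.contMDiff.continuous.continuousAt.eventually
      (φ.open_source.mem_nhds hq)] with q' hq'
    exact φ.left_inv hq'
  have hid : MDifferentiableAt (𝓡 m) (𝓡 n) i q := (hi.contMDiff q).mdifferentiableAt hk0
  have hΦd : MDifferentiableAt (𝓡 m) (𝓡 n) (φ ∘ i) q := (hφd.mdifferentiableAt hq).comp q hid
  have h2 := fun v => mfderiv_comp_apply q (hφd.mdifferentiableAt_symm (φ.map_source hq)) hΦd v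
  rw [← hi.inner_map, ← inner_mfderiv_congr h1]
  have h3 := inner_mfderiv_symm φ (φ (i q)) (mfderiv (𝓡 m) (𝓡 n) (φ ∘ i) q v)
    (mfderiv (𝓡 m) (𝓡 n) (φ ∘ i) q w)
  rw [h2, h2]
  exact h3

lemma inner_mfderiv_chart_symm (hi : IsIsometricImmersion (m := m) (n := n) k i)
    (hk : 1 ≤ k) (hφ : φ ∈ IsManifold.maximalAtlas (𝓡 n) (k : WithTop ℕ∞) M)
    {ψ : OpenPartialHomeomorph S (Euc m)} (hψ : ψ.MDifferentiable (𝓡 m) (𝓡 m)) {y : Euc m}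
    (hy : y ∈ ψ.target) (hyN : i (ψ.symm y) ∈ φ.source) (v w : Euc m) :
    inner ℝ (mfderiv (𝓡 m) (𝓡 m) ψ.symm y v) (mfderiv (𝓡 m) (𝓡 m) ψ.symm y w)
      = ∑ a, ∑ b, metricMatrix φ (φ (i (ψ.symm y))) a b
        * fderiv ℝ (φ ∘ i ∘ ψ.symm) y v a * fderiv ℝ (φ ∘ i ∘ ψ.symm) y w b := by
  have hk0 : (k : WithTop ℕ∞) ≠ 0 := by exact_mod_cast (by omega : k ≠ 0)
  have hφd := mdifferentiable_of_mem_maximalAtlas hk hφ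
  have hid : MDifferentiableAt (𝓡 m) (𝓡 n) i (ψ.symm y) := (hi.contMDiff _).mdifferentiableAt hk0
  have hΦd : MDifferentiableAt (𝓡 m) (𝓡 n) (φ ∘ i) (ψ.symm y) :=
    (hφd.mdifferentiableAt hyN).comp _ hid
  rw [inner_eq_sum_of_isometricImmersion hi hk hφ hyN]
  have h1 := fun v => fderiv_comp_chart_symm hψ hy hΦd v
  have h2 : (φ ∘ i) ∘ ψ.symm = φ ∘ i ∘ ψ.symm := rfl
  rw [h2] at h1
  simp only [h1]

end Immersion

section Immersion

variable {m n : ℕ} {S M : Type*} [TopologicalSpace S] [ChartedSpace (Euc m) S]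
  [RiemannianBundle (fun x : S => TangentSpace (𝓡 m) x)]
  [TopologicalSpace M] [ChartedSpace (Euc n) M]
  [RiemannianBundle (fun x : M => TangentSpace (𝓡 n) x)]
  {k : ℕ} {i : S → M} {φ : OpenPartialHomeomorph M (Euc n)}

lemma injective_modelDeriv (hi : IsIsometricImmersion (m := m) (n := n) k i)
    (hk : 1 ≤ k) (hφ : φ ∈ IsManifold.maximalAtlas (𝓡 n) (k : WithTop ℕ∞) M) {q : S}
    (hq : i q ∈ φ.source) : Function.Injective (modelDeriv (m := m) (φ ∘ i) q) := by
  rw [injective_iff_map_eq_zero]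
  intro v hv
  have h := inner_eq_sum_of_isometricImmersion hi hk hφ hq v v
  simp only [hv, PiLp.zero_apply, mul_zero, Finset.sum_const_zero] at h
  exact (inner_self_eq_zero (𝕜 := ℝ) (E := TangentSpace (𝓡 m) q)).1 h

end Immersion

section Distance

variable {m : ℕ} {S : Type*} [PseudoEMetricSpace S] [ChartedSpace (Euc m) S]
  [RiemannianBundle (fun x : S => TangentSpace (𝓡 m) x)] [IsRiemannianManifold (𝓡 m) S]

/-- The distance is at most the length of the image of the straight segment, whose speed is at most
`H ‖y - x‖`. Convexity keeps the segment in the target. -/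
lemma edist_chart_symm_le {ψ : OpenPartialHomeomorph S (Euc m)}
    (hψ : ψ ∈ IsManifold.maximalAtlas (𝓡 m) 1 S)
    (hconv : Convex ℝ ψ.target) {H : ℝ} (hH : 0 ≤ H)
    (hbound : ∀ y ∈ ψ.target, ∀ v : Euc m, inner ℝ (mfderiv (𝓡 m) (𝓡 m) ψ.symm y v)
      (mfderiv (𝓡 m) (𝓡 m) ψ.symm y v) ≤ (H * ‖v‖) ^ 2)
    {x y : Euc m} (hx : x ∈ ψ.target) (hy : y ∈ ψ.target) :
    edist (ψ.symm x) (ψ.symm y) ≤ ENNReal.ofReal H * edist x y := by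
  let c : ℝ → Euc m := fun t => AffineMap.lineMap x y t
  have hc : ContDiff ℝ 1 c := by
    have : c = fun t => t • (y - x) + x := by
      ext1 t; simp [c, AffineMap.lineMap_apply]
    rw [this]; fun_prop
  have hct : ∀ t ∈ Icc (0 : ℝ) 1, c t ∈ ψ.target := fun t ht =>
    hconv.segment_subset hx hy (by
      rw [segment_eq_image_lineMap]; exact ⟨t, ht, rfl⟩)
  have hcd : ∀ t, HasDerivAt c (y - x) t := fun t => AffineMap.hasDerivAt_lineMap
  have hγ : ContMDiffOn 𝓘(ℝ, ℝ) (𝓡 m) 1 (ψ.symm ∘ c) (Icc 0 1) :=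
    (contMDiffOn_symm_of_mem_maximalAtlas hψ).comp hc.contMDiff.contMDiffOn hct
  rw [IsRiemannianManifold.out (I := 𝓡 m) (ψ.symm x) (ψ.symm y)]
  refine (Manifold.riemannianEDist_le_pathELength hγ (by simp [c]) (by simp [c])
    zero_le_one).trans ?_
  rw [Manifold.pathELength_eq_lintegral_mfderiv_Icc]
  have hle : ∀ t ∈ Icc (0 : ℝ) 1, ‖mfderiv 𝓘(ℝ, ℝ) (𝓡 m) (ψ.symm ∘ c) t 1‖ₑ
      ≤ ENNReal.ofReal H * edist x y := by
    intro t ht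
    have hd1 : MDifferentiableAt (𝓡 m) (𝓡 m) ψ.symm (c t) :=
      mdifferentiableAt_symm_of_mem_maximalAtlas hψ (hct t ht)
    have hd2 : MDifferentiableAt 𝓘(ℝ, ℝ) (𝓡 m) c t := (hcd t).differentiableAt.mdifferentiableAt
    have h1 := mfderiv_comp_apply t hd1 hd2 (1 : ℝ)
    have h2 : (mfderiv 𝓘(ℝ, ℝ) (𝓡 m) c t (1 : ℝ) : Euc m) = y - x := by
      rw [mfderiv_eq_fderiv]
      exact (hcd t).deriv
    have h3 : mfderiv 𝓘(ℝ, ℝ) (𝓡 m) (ψ.symm ∘ c) t (1 : ℝ)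
        = mfderiv (𝓡 m) (𝓡 m) ψ.symm (c t) (y - x : Euc m) :=
      h1.trans (congrArg (fun v : Euc m => mfderiv (𝓡 m) (𝓡 m) ψ.symm (c t) v) h2)
    have h4 := hbound (c t) (hct t ht) (y - x)
    rw [real_inner_self_eq_norm_sq] at h4
    have h5 : ‖mfderiv (𝓡 m) (𝓡 m) ψ.symm (c t) (y - x : Euc m)‖ ≤ H * ‖y - x‖ :=
      (abs_le_of_sq_le_sq' h4 (by positivity)).2
    calc ‖mfderiv 𝓘(ℝ, ℝ) (𝓡 m) (ψ.symm ∘ c) t (1 : ℝ)‖ₑ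
        = ‖mfderiv (𝓡 m) (𝓡 m) ψ.symm (c t) (y - x : Euc m)‖ₑ := congrArg _ h3
      _ = ENNReal.ofReal ‖mfderiv (𝓡 m) (𝓡 m) ψ.symm (c t) (y - x : Euc m)‖ := (ofReal_norm _).symm
      _ ≤ ENNReal.ofReal (H * ‖y - x‖) := ENNReal.ofReal_le_ofReal h5
      _ = ENNReal.ofReal H * edist x y := by
        rw [ENNReal.ofReal_mul hH, edist_comm, edist_eq_enorm_sub, ofReal_norm]
  calc _ ≤ ∫⁻ _ in Icc (0 : ℝ) 1, ENNReal.ofReal H * edist x y :=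
        MeasureTheory.setLIntegral_mono measurable_const hle
    _ = _ := by simp

end Distance

/-! ### Estimates for graph charts -/

section GraphChart

variable {m n l k : ℕ} {S M : Type*} [TopologicalSpace S] [ChartedSpace (Euc m) S]
  [TopologicalSpace M] {i : S → M} {φ : OpenPartialHomeomorph M (Euc n)}
  {ψ : OpenPartialHomeomorph S (Euc m)} {P : Euc n →L[ℝ] Euc m} {Q : Euc n →L[ℝ] Euc l}

/-- `ψ` is a `C^k` chart of the submanifold in which it is a graph of slope less than `1`, in the
chart `φ` of the ambient manifold, over its coordinates `P`. -/
structure IsGraphChart (k : ℕ) (i : S → M) (φ : OpenPartialHomeomorph M (Euc n))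
    (ψ : OpenPartialHomeomorph S (Euc m)) (P : Euc n →L[ℝ] Euc m) (Q : Euc n →L[ℝ] Euc l) :
    Prop where
  mem_atlas : ψ ∈ IsManifold.maximalAtlas (𝓡 m) (k : WithTop ℕ∞) S
  source_subset : ψ.source ⊆ graphRegion (φ ∘ i) (i ⁻¹' φ.source) P Q
  apply_symm : ∀ y ∈ ψ.target, P (φ (i (ψ.symm y))) = y

namespace IsGraphChart

lemma mem_source (h : IsGraphChart k i φ ψ P Q) {y : Euc m} (hy : y ∈ ψ.target) :
    i (ψ.symm y) ∈ φ.source := (h.source_subset (ψ.map_target hy)).1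

variable [ChartedSpace (Euc n) M]

lemma contDiffAt (h : IsGraphChart k i φ ψ P Q)
    (hi : ContMDiff (𝓡 m) (𝓡 n) (k : WithTop ℕ∞) i)
    (hφ : φ ∈ IsManifold.maximalAtlas (𝓡 n) (k : WithTop ℕ∞) M) {y : Euc m} (hy : y ∈ ψ.target) :
    ContDiffAt ℝ k (φ ∘ i ∘ ψ.symm) y := by
  have h1 := contMDiffAt_symm_of_mem_maximalAtlas h.mem_atlas hy
  have h2 := contMDiffAt_of_mem_maximalAtlas hφ (h.mem_source hy)
  exact (h2.comp y ((hi (ψ.symm y)).comp y h1)).contDiffAt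

lemma fderiv_eq (h : IsGraphChart k i φ ψ P Q) (hk : 1 ≤ k)
    (hi : ContMDiff (𝓡 m) (𝓡 n) (k : WithTop ℕ∞) i)
    (hφ : φ ∈ IsManifold.maximalAtlas (𝓡 n) (k : WithTop ℕ∞) M) {y : Euc m} (hy : y ∈ ψ.target)
    (v : Euc m) : fderiv ℝ (φ ∘ i ∘ ψ.symm) y v
      = modelDeriv (m := m) (φ ∘ i) (ψ.symm y) (mfderiv (𝓡 m) (𝓡 m) ψ.symm y v) := by
  have hk0 : (k : WithTop ℕ∞) ≠ 0 := by exact_mod_cast (by omega : k ≠ 0)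
  refine fderiv_comp_chart_symm (Φ := φ ∘ i) (mdifferentiable_of_mem_maximalAtlas hk h.mem_atlas) hy ?_ v
  exact ((contMDiffAt_of_mem_maximalAtlas hφ (h.mem_source hy)).comp _
    (hi (ψ.symm y))).mdifferentiableAt hk0

lemma fderiv_head (h : IsGraphChart k i φ ψ P Q) (hk : 1 ≤ k)
    (hi : ContMDiff (𝓡 m) (𝓡 n) (k : WithTop ℕ∞) i)
    (hφ : φ ∈ IsManifold.maximalAtlas (𝓡 n) (k : WithTop ℕ∞) M) {y : Euc m} (hy : y ∈ ψ.target)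
    (v : Euc m) : P (fderiv ℝ (φ ∘ i ∘ ψ.symm) y v) = v := by
  have hk0 : (k : WithTop ℕ∞) ≠ 0 := by exact_mod_cast (by omega : k ≠ 0)
  have h1 : HasFDerivAt (fun z => P ((φ ∘ i ∘ ψ.symm) z))
      (P.comp (fderiv ℝ (φ ∘ i ∘ ψ.symm) y)) y :=
    P.hasFDerivAt.comp y ((h.contDiffAt hi hφ hy).differentiableAt hk0).hasFDerivAt
  have h2 : HasFDerivAt (fun z => P ((φ ∘ i ∘ ψ.symm) z)) (ContinuousLinearMap.id ℝ (Euc m)) y := by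
    refine (hasFDerivAt_id y).congr_of_eventuallyEq ?_
    filter_upwards [ψ.open_target.mem_nhds hy] with z hz using h.apply_symm z hz
  exact congrArg (fun L : Euc m →L[ℝ] Euc m => L v) (h1.unique h2)

/-- With `P (DF v) = v` and slope at most `1`, `‖DF v‖² ≤ 2 ‖v‖²`; the constant `2` is rounded up
from `√2`. -/
lemma norm_fderiv_le (h : IsGraphChart k i φ ψ P Q) (hk : 1 ≤ k)
    (hi : ContMDiff (𝓡 m) (𝓡 n) (k : WithTop ℕ∞) i)
    (hφ : φ ∈ IsManifold.maximalAtlas (𝓡 n) (k : WithTop ℕ∞) M)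
    (hPQ : ∀ z : Euc n, ‖z‖ ^ 2 = ‖P z‖ ^ 2 + ‖Q z‖ ^ 2) {y : Euc m} (hy : y ∈ ψ.target) :
    ‖fderiv ℝ (φ ∘ i ∘ ψ.symm) y‖ ≤ 2 := by
  refine ContinuousLinearMap.opNorm_le_bound _ zero_le_two fun v => ?_
  have h1 : ‖Q (fderiv ℝ (φ ∘ i ∘ ψ.symm) y v)‖ ≤ ‖v‖ := by
    have h2 := (h.source_subset (ψ.map_target hy)).2
    set w : Euc m := mfderiv (𝓡 m) (𝓡 m) ψ.symm y v with hw
    have h3 := h.fderiv_eq hk hi hφ hy v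
    have h4 : ‖Q (fderiv ℝ (φ ∘ i ∘ ψ.symm) y v)‖ ≤ ‖P (fderiv ℝ (φ ∘ i ∘ ψ.symm) y v)‖ := by
      rw [h3]
      rcases eq_or_ne w 0 with h0 | h0
      · rw [← hw, h0]; simp
      · exact (h2 w h0).le
    rwa [h.fderiv_head hk hi hφ hy] at h4
  have h2 := hPQ (fderiv ℝ (φ ∘ i ∘ ψ.symm) y v)
  rw [h.fderiv_head hk hi hφ hy] at h2
  refine (abs_le_of_sq_le_sq' ?_ (by positivity)).2
  nlinarith [norm_nonneg (Q (fderiv ℝ (φ ∘ i ∘ ψ.symm) y v)), norm_nonneg v]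

variable [RiemannianBundle (fun x : S => TangentSpace (𝓡 m) x)]
  [RiemannianBundle (fun x : M => TangentSpace (𝓡 n) x)]
  {Γ B ρ : ℝ} {p₀ : M}

lemma inner_mfderiv_le (h : IsGraphChart k i φ ψ P Q) (hk : 1 ≤ k) (hΓ : 0 < Γ)
    (hi : IsIsometricImmersion (m := m) (n := n) k i)
    (hφ : IsNormalisedChart Γ k ρ p₀ φ)
    (hPQ : ∀ z : Euc n, ‖z‖ ^ 2 = ‖P z‖ ^ 2 + ‖Q z‖ ^ 2) {y : Euc m} (hy : y ∈ ψ.target)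
    (v : Euc m) :
    inner ℝ (mfderiv (𝓡 m) (𝓡 m) ψ.symm y v) (mfderiv (𝓡 m) (𝓡 m) ψ.symm y v)
      ≤ (2 * √Γ * ‖v‖) ^ 2 := by
  rw [inner_mfderiv_chart_symm hi hk hφ.mem_atlas
    (mdifferentiable_of_mem_maximalAtlas hk h.mem_atlas) hy (h.mem_source hy)]
  have h1 : ‖Matrix.toEuclideanCLM (𝕜 := ℝ) (metricMatrix φ (φ (i (ψ.symm y))))‖ ≤ Γ := by
    simpa using norm_iteratedFDeriv_le_of_ckNorm_le hΓ.le hφ.metric_le (Nat.zero_le _)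
      (φ.map_source (h.mem_source hy))
  refine (quadratic_le_of_norm_le h1 _).trans ?_
  have h2 : ‖fderiv ℝ (φ ∘ i ∘ ψ.symm) y v‖ ≤ 2 * ‖v‖ :=
    ContinuousLinearMap.le_of_opNorm_le _ (h.norm_fderiv_le hk hi.contMDiff hφ.mem_atlas hPQ hy) v
  calc Γ * ‖fderiv ℝ (φ ∘ i ∘ ψ.symm) y v‖ ^ 2 ≤ Γ * (2 * ‖v‖) ^ 2 := by gcongr
    _ = (2 * √Γ * ‖v‖) ^ 2 := by
      rw [mul_pow, mul_pow, mul_pow, Real.sq_sqrt hΓ.le]; ring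

/-- Graph charts define germs to which the derivative estimate applies. -/
lemma exists_graphGerm {N : ℕ} [IsManifold (𝓡 n) 1 M] [IsManifold (𝓡 n) ((N + 2 : ℕ) : WithTop ℕ∞) M]
    [IsContMDiffRiemannianBundle (𝓡 n) ((N + 1 : ℕ) : WithTop ℕ∞) (Euc n)
      (fun x : M => TangentSpace (𝓡 n) x)]
    (h : IsGraphChart (N + 2) i φ ψ P Q) (hΓ : 0 < Γ)
    (hi : IsIsometricImmersion (m := m) (n := n) (N + 2) i)
    (hφ : IsNormalisedChart Γ (N + 2) ρ p₀ φ)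
    (hPQ : ∀ z : Euc n, ‖z‖ ^ 2 = ‖P z‖ ^ 2 + ‖Q z‖ ^ 2) {y : Euc m} (hy : y ∈ ψ.target)
    (hB : formBound (m := m) (n := n) (N + 2) i (ψ.symm y) ≤ ENNReal.ofReal B) :
    ∃ D : GraphGerm m n N Γ B, D.x = y ∧ D.F = φ ∘ i ∘ ψ.symm := by
  have hk : 1 ≤ N + 2 := by omega
  have hφd := mdifferentiable_of_mem_maximalAtlas hk hφ.mem_atlas
  have hψd := mdifferentiable_of_mem_maximalAtlas hk h.mem_atlas
  have hPle : ‖P‖ ≤ 1 := by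
    refine ContinuousLinearMap.opNorm_le_bound _ zero_le_one fun z => ?_
    rw [one_mul]
    refine (abs_le_of_sq_le_sq' ?_ (norm_nonneg z)).2
    rw [hPQ z]
    nlinarith [sq_nonneg ‖Q z‖]
  have hF : φ (i (ψ.symm y)) ∈ φ.target := φ.map_source (h.mem_source hy)
  refine ⟨{ x := y, F := φ ∘ i ∘ ψ.symm, G := metricMatrix φ, h := metricMatrix ψ, ℓ := P,
            contDiffAt := h.contDiffAt hi.contMDiff hφ.mem_atlas hy
            norm_fderiv_le := h.norm_fderiv_le hk hi.contMDiff hφ.mem_atlas hPQ hy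
            norm_ℓ_le := hPle
            ℓ_comp := ?_
            contDiffAt_G := fun a b => contDiffAt_metricMatrix hφ.mem_atlas hF a b
            posDef := posDef_metricMatrix hφd hF
            norm_G_le := fun j hj =>
              norm_iteratedFDeriv_le_of_ckNorm_le hΓ.le hφ.metric_le hj hF
            norm_inv_G_le := fun j hj =>
              norm_iteratedFDeriv_le_of_ckNorm_le hΓ.le hφ.inv_metric_le hj hF
            h_eq := ?_
            tensorNorm_le := fun j hj => ?_ }, rfl, rfl⟩
  · filter_upwards [ψ.open_target.mem_nhds hy] with z hz using h.apply_symm z hz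
  · filter_upwards [ψ.open_target.mem_nhds hy] with z hz a b
    have h1 := inner_mfderiv_chart_symm hi hk hφ.mem_atlas hψd hz (h.mem_source hz)
      (EuclideanSpace.single a 1) (EuclideanSpace.single b 1)
    have hd : DifferentiableAt ℝ (φ ∘ i ∘ ψ.symm) z :=
      ((h.contDiffAt hi.contMDiff hφ.mem_atlas hz).eventually_differentiableAt hk).self_of_nhds
    simp only [GraphGerm.pd_apply_eq hd]
    exact h1
  · have h1 : formBoundInCharts (N + 2) i (ψ.symm y) ψ φ ≤ ENNReal.ofReal B := by
      refine le_trans ?_ hB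
      have hm : ψ ∈ {ψ' ∈ IsManifold.maximalAtlas (𝓡 m) ((N + 2 : ℕ) : WithTop ℕ∞) S |
          ψ.symm y ∈ ψ'.source} := ⟨h.mem_atlas, ψ.map_target hy⟩
      have hm' : φ ∈ {φ' ∈ IsManifold.maximalAtlas (𝓡 n) ((N + 2 : ℕ) : WithTop ℕ∞) M |
          i (ψ.symm y) ∈ φ'.source} := ⟨hφ.mem_atlas, h.mem_source hy⟩
      unfold formBound
      exact le_iSup₂_of_le ψ hm (le_iSup₂_of_le φ hm' le_rfl)
    refine le_trans ?_ h1
    -- The range has `N + 1` elements, the indices `0, …, N`, so each form is one of the nonnegative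
    -- summands.
    have h2 := Finset.single_le_sum (f := fun j =>
      tensorNorm (metricMatrix ψ (ψ (ψ.symm y))) (metricMatrix φ (φ (i (ψ.symm y))))
        (higherForm (metricMatrix ψ) (metricMatrix φ) (φ ∘ i ∘ ψ.symm) j (ψ (ψ.symm y))))
      (s := Finset.range (N + 2 - 1)) (fun _ _ => zero_le) (a := j)
      (Finset.mem_range.2 (by omega))
    rw [formBoundInCharts]
    rw [ψ.right_inv hy] at h2 ⊢
    exact h2

end IsGraphChart
end GraphChart

/-! ### Control of graph charts over balls -/

section Control

variable {m n l k : ℕ} {M : Type*}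
  [TopologicalSpace M] [ChartedSpace (Euc n) M]
  {φ : OpenPartialHomeomorph M (Euc n)} {P : Euc n →L[ℝ] Euc m} {Q : Euc n →L[ℝ] Euc l}

namespace IsGraphChart

section Slope

variable {S : Type*} [TopologicalSpace S] [ChartedSpace (Euc m) S] {i : S → M}
  {ψ : OpenPartialHomeomorph S (Euc m)} {s C : ℝ}

lemma norm_apply_le (h : IsGraphChart k i φ ψ P Q) (hk : 1 ≤ k)
    (hi : ContMDiff (𝓡 m) (𝓡 n) (k : WithTop ℕ∞) i)
    (hφ : φ ∈ IsManifold.maximalAtlas (𝓡 n) (k : WithTop ℕ∞) M)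
    (hPQ : ∀ z : Euc n, ‖z‖ ^ 2 = ‖P z‖ ^ 2 + ‖Q z‖ ^ 2) (hs : ψ.target = Metric.ball 0 s)
    (h0 : φ (i (ψ.symm 0)) = 0) {y : Euc m} (hy : y ∈ ψ.target) :
    ‖φ (i (ψ.symm y))‖ ≤ 2 * ‖y‖ := by
  have hk0 : (k : WithTop ℕ∞) ≠ 0 := by exact_mod_cast (by omega : k ≠ 0)
  have h0m : (0 : Euc m) ∈ ψ.target := by
    rw [hs] at hy ⊢
    exact Metric.mem_ball_self (Metric.pos_of_mem_ball hy)
  have h1 := (hs ▸ convex_ball (0 : Euc m) s : Convex ℝ ψ.target).norm_image_sub_le_of_norm_fderiv_le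
    (f := φ ∘ i ∘ ψ.symm) (C := 2)
    (fun x hx => (h.contDiffAt hi hφ hx).differentiableAt hk0)
    (fun x hx => h.norm_fderiv_le hk hi hφ hPQ hx) h0m hy
  simpa [h0] using h1

/-- The improvement that drives the continuation: since `Q ∘ DF` vanishes at `0`, the mean value
inequality for `DF` gives slope at most `C s`, which is at most `1 / 2`. -/
lemma norm_tail_le (h : IsGraphChart k i φ ψ P Q) (hk : 2 ≤ k)
    (hi : ContMDiff (𝓡 m) (𝓡 n) (k : WithTop ℕ∞) i)
    (hφ : φ ∈ IsManifold.maximalAtlas (𝓡 n) (k : WithTop ℕ∞) M)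
    (hPQ : ∀ z : Euc n, ‖z‖ ^ 2 = ‖P z‖ ^ 2 + ‖Q z‖ ^ 2) (hs : ψ.target = Metric.ball 0 s)
    (hC : ∀ y ∈ ψ.target, ‖iteratedFDeriv ℝ 2 (φ ∘ i ∘ ψ.symm) y‖ ≤ C) (hCs : C * s ≤ 1 / 2)
    (h0 : ∀ v, Q (modelDeriv (m := m) (φ ∘ i) (ψ.symm 0) v) = 0) {y : Euc m} (hy : y ∈ ψ.target)
    (v : Euc m) : ‖Q (modelDeriv (m := m) (φ ∘ i) (ψ.symm y) v)‖
      ≤ 1 / 2 * ‖P (modelDeriv (m := m) (φ ∘ i) (ψ.symm y) v)‖ := by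
  have hk1 : 1 ≤ k := by omega
  have h0m : (0 : Euc m) ∈ ψ.target := by
    rw [hs] at hy ⊢
    exact Metric.mem_ball_self (Metric.pos_of_mem_ball hy)
  have hC0 : 0 ≤ C := (norm_nonneg _).trans (hC 0 h0m)
  have hys : ‖y‖ < s := by rw [hs] at hy; exact mem_ball_zero_iff.1 hy
  obtain ⟨w, rfl⟩ : ∃ w : Euc m, mfderiv (𝓡 m) (𝓡 m) ψ.symm y w = v :=
    ((mdifferentiable_of_mem_maximalAtlas hk1 h.mem_atlas).symm.mfderiv_bijective hy).2 v
  rw [← h.fderiv_eq hk1 hi hφ hy w, h.fderiv_head hk1 hi hφ hy w]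
  set F := φ ∘ i ∘ ψ.symm with hF
  have h1 : ‖fderiv ℝ F y - fderiv ℝ F 0‖ ≤ C * ‖y - 0‖ := by
    refine (hs ▸ convex_ball (0 : Euc m) s :
      Convex ℝ ψ.target).norm_image_sub_le_of_norm_fderiv_le (𝕜 := ℝ) (fun x hx => ?_) (fun x hx => ?_) h0m hy
    · have h2 : ContDiffAt ℝ (1 : ℕ) (fderiv ℝ F) x :=
        (h.contDiffAt hi hφ hx).fderiv_right (by exact_mod_cast hk)
      exact h2.differentiableAt (by simp)
    · rw [← norm_iteratedFDeriv_one, norm_iteratedFDeriv_fderiv]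
      exact hC x hx
  rw [sub_zero] at h1
  have h2 : Q (fderiv ℝ F 0 w) = 0 := by rw [h.fderiv_eq hk1 hi hφ h0m w]; exact h0 _
  have h3 : Q (fderiv ℝ F y w) = Q ((fderiv ℝ F y - fderiv ℝ F 0) w) := by
    simp [h2]
  have hQ : ∀ z, ‖Q z‖ ≤ ‖z‖ := fun z => by
    refine (abs_le_of_sq_le_sq' ?_ (norm_nonneg z)).2
    rw [hPQ z]
    nlinarith [sq_nonneg ‖P z‖]
  calc ‖Q (fderiv ℝ F y w)‖ ≤ ‖(fderiv ℝ F y - fderiv ℝ F 0) w‖ := h3 ▸ hQ _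
    _ ≤ (C * ‖y‖) * ‖w‖ := ContinuousLinearMap.le_of_opNorm_le _ h1 w
    _ ≤ 1 / 2 * ‖w‖ := by
      gcongr
      exact (mul_le_mul_of_nonneg_left hys.le hC0).trans hCs

end Slope

section Metric

variable {S : Type*} [EMetricSpace S] [ChartedSpace (Euc m) S]
  [RiemannianBundle (fun x : S => TangentSpace (𝓡 m) x)] [IsRiemannianManifold (𝓡 m) S]
  [RiemannianBundle (fun x : M => TangentSpace (𝓡 n) x)] {i : S → M}
  {ψ : OpenPartialHomeomorph S (Euc m)} {s C Γ ρ : ℝ} {p₀ : M}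

lemma edist_symm_le (h : IsGraphChart k i φ ψ P Q) (hk : 1 ≤ k) (hΓ : 0 < Γ)
    (hi : IsIsometricImmersion (m := m) (n := n) k i) (hφ : IsNormalisedChart Γ k ρ p₀ φ)
    (hPQ : ∀ z : Euc n, ‖z‖ ^ 2 = ‖P z‖ ^ 2 + ‖Q z‖ ^ 2) (hconv : Convex ℝ ψ.target)
    {x y : Euc m} (hx : x ∈ ψ.target) (hy : y ∈ ψ.target) :
    edist (ψ.symm x) (ψ.symm y) ≤ ENNReal.ofReal (2 * √Γ) * edist x y :=
  edist_chart_symm_le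
    (IsManifold.maximalAtlas_subset_of_le (by exact_mod_cast hk) h.mem_atlas) hconv (by positivity)
    (fun _ hz v => h.inner_mfderiv_le hk hΓ hi hφ hPQ hz v) hx hy

/-- Graph charts over a ball have limits at the boundary in a complete submanifold, and it is a
graph there as well. -/
lemma exists_tendsto [T2Space M] [CompleteSpace S]
    [IsManifold (𝓡 m) (k : WithTop ℕ∞) S] (h : IsGraphChart k i φ ψ P Q) (hk : 2 ≤ k) (hΓ : 0 < Γ)
    (hi : IsIsometricImmersion (m := m) (n := n) k i) (hφ : IsNormalisedChart Γ k ρ p₀ φ)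
    (hPQ : ∀ z : Euc n, ‖z‖ ^ 2 = ‖P z‖ ^ 2 + ‖Q z‖ ^ 2) (hs : ψ.target = Metric.ball 0 s)
    (hspos : 0 < s) (hsρ : 2 * s ≤ ρ)
    (hC : ∀ y ∈ ψ.target, ‖iteratedFDeriv ℝ 2 (φ ∘ i ∘ ψ.symm) y‖ ≤ C) (hCs : C * s ≤ 1 / 2)
    (hφ0 : φ (i (ψ.symm 0)) = 0)
    (h0 : ∀ v, Q (modelDeriv (m := m) (φ ∘ i) (ψ.symm 0) v) = 0) {z : Euc m}
    (hz : z ∈ Metric.sphere (0 : Euc m) s) :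
    ∃ q ∈ graphRegion (φ ∘ i) (i ⁻¹' φ.source) P Q,
      Filter.Tendsto ψ.symm (𝓝[Metric.ball 0 s] z) (𝓝 q) := by
  have hk1 : 1 ≤ k := by omega
  have hk0 : (k : WithTop ℕ∞) ≠ 0 := by exact_mod_cast (by omega : k ≠ 0)
  have hcont : Continuous i := hi.contMDiff.continuous
  have hconv : Convex ℝ ψ.target := hs ▸ convex_ball (0 : Euc m) s
  have hne : (𝓝[Metric.ball 0 s] z).NeBot := by
    rw [← mem_closure_iff_nhdsWithin_neBot, closure_ball _ hspos.ne']
    exact Metric.sphere_subset_closedBall hz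
  have hev : ∀ᶠ y in 𝓝[Metric.ball 0 s] z, y ∈ ψ.target := by
    rw [hs]; exact self_mem_nhdsWithin
  -- Lipschitz maps preserve Cauchy filters, so completeness of `S` provides the boundary point `q`.
  have hlip : LipschitzOnWith (Real.toNNReal (2 * √Γ)) ψ.symm (Metric.ball 0 s) :=
    fun x hx y hy => h.edist_symm_le hk1 hΓ hi hφ hPQ hconv (hs ▸ hx) (hs ▸ hy)
  have hcauchy : Cauchy (Filter.map ψ.symm (𝓝[Metric.ball 0 s] z)) :=
    (cauchy_nhds.mono nhdsWithin_le_nhds).map_of_le hlip.uniformContinuousOn inf_le_right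
  obtain ⟨q, hq⟩ := CompleteSpace.complete hcauchy
  have hqt : Filter.Tendsto ψ.symm (𝓝[Metric.ball 0 s] z) (𝓝 q) := hq
  have hΦlip : LipschitzOnWith 2 (φ ∘ i ∘ ψ.symm) (Metric.ball 0 s) := by
    refine (hs ▸ hconv).lipschitzOnWith_of_nnnorm_fderiv_le (𝕜 := ℝ) (fun x hx => ?_) fun x hx => ?_
    · exact (h.contDiffAt hi.contMDiff hφ.mem_atlas (hs ▸ hx)).differentiableAt hk0
    · exact h.norm_fderiv_le hk1 hi.contMDiff hφ.mem_atlas hPQ (hs ▸ hx)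
  obtain ⟨w, hw⟩ := CompleteSpace.complete
    ((cauchy_nhds.mono nhdsWithin_le_nhds).map_of_le hΦlip.uniformContinuousOn
      (inf_le_right : 𝓝[Metric.ball 0 s] z ≤ _))
  have hwt : Filter.Tendsto (φ ∘ i ∘ ψ.symm) (𝓝[Metric.ball 0 s] z) (𝓝 w) := hw
  -- It is not yet known that `i q` lies in the domain of `φ`. The limit `w` of the coordinates lies
  -- in the closed ball of radius `ρ`, since `‖F y‖ ≤ 2 s ≤ ρ`, and `φ.symm w` is then the limit of
  -- `i` as well.
  have hwρ : w ∈ φ.target := by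
    refine hφ.ball_subset (Metric.isClosed_closedBall.mem_of_tendsto hwt ?_)
    filter_upwards [hev] with y hy
    rw [mem_closedBall_zero_iff]
    have h1 := h.norm_apply_le hk1 hi.contMDiff hφ.mem_atlas hPQ hs hφ0 hy
    have h2 : ‖y‖ < s := by rw [hs] at hy; exact mem_ball_zero_iff.1 hy
    exact h1.trans (by linarith)
  have hiq : i q = φ.symm w := by
    refine tendsto_nhds_unique ((hcont.tendsto q).comp hqt) ?_
    refine ((φ.continuousAt_symm hwρ).tendsto.comp hwt).congr' ?_
    filter_upwards [hev] with y hy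
    exact φ.left_inv (h.mem_source hy)
  have hqN : i q ∈ φ.source := hiq ▸ φ.map_target hwρ
  refine ⟨q, ?_, hqt⟩
  refine mem_graphRegion_of_tendsto (k := k) hk1 (φ.open_source.preimage hcont) ?_ hPQ hqN
    (injective_modelDeriv hi hk1 hφ.mem_atlas hqN) hqt ?_
  · exact (contMDiffOn_of_mem_maximalAtlas hφ.mem_atlas).comp hi.contMDiff.contMDiffOn
      fun _ hq' => hq'
  · filter_upwards [hev] with y hy v
    exact h.norm_tail_le hk hi.contMDiff hφ.mem_atlas hPQ hs hC hCs h0 hy v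

end Metric
end IsGraphChart
end Control

lemma ckNorm_le_of_forall {E F : Type*} [NormedAddCommGroup E] [NormedSpace ℝ E]
    [NormedAddCommGroup F] [NormedSpace ℝ F] {k : ℕ} {f : E → F} {Ω : Set E} {C : ℝ}
    (h : ∀ j ≤ k, ∀ x ∈ Ω, ‖iteratedFDeriv ℝ j f x‖ ≤ C) :
    ckNorm k f Ω ≤ ENNReal.ofReal ((k + 1) * C) := by
  calc ckNorm k f Ω ≤ ∑ j ∈ Finset.range (k + 1), ENNReal.ofReal C := by
        refine Finset.sum_le_sum fun j hj => iSup₂_le fun x hx => ?_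
        rw [← ofReal_norm]
        exact ENNReal.ofReal_le_ofReal (h j (by simpa [Nat.lt_succ_iff] using hj) x hx)
    _ = ENNReal.ofReal ((k + 1) * C) := by
        rw [Finset.sum_const, Finset.card_range, nsmul_eq_mul,
          ENNReal.ofReal_mul (by positivity), ← Nat.cast_succ, ENNReal.ofReal_natCast]

/-- Existence of graph charts over balls of uniform radius. -/
theorem exists_isGraphChart_ball {m n N : ℕ} {Γ B ρ C r : ℝ} (hΓ : 0 < Γ) (hr : 0 < r)
    (hrρ : 2 * r ≤ ρ) (hrH : 2 * √Γ * r ≤ ρ) (hrC : C * r ≤ 1 / 2) (hC0 : 0 ≤ C)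
    (hC : ∀ (D : GraphGerm m n N Γ B) (j : ℕ), 2 ≤ j → j ≤ N + 2 →
      ‖iteratedFDeriv ℝ j D.F D.x‖ ≤ C)
    {M : Type*} [TopologicalSpace M] [T2Space M] [ChartedSpace (Euc n) M]
    [IsManifold (𝓡 n) ((N + 2 : ℕ) : WithTop ℕ∞) M] [IsManifold (𝓡 n) 1 M]
    [RiemannianBundle (fun x : M => TangentSpace (𝓡 n) x)]
    [IsContMDiffRiemannianBundle (𝓡 n) ((N + 1 : ℕ) : WithTop ℕ∞) (Euc n)
      (fun x : M => TangentSpace (𝓡 n) x)]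
    {S : Type*} [EMetricSpace S] [ChartedSpace (Euc m) S]
    [IsManifold (𝓡 m) ((N + 2 : ℕ) : WithTop ℕ∞) S]
    [RiemannianBundle (fun x : S => TangentSpace (𝓡 m) x)]
    [IsRiemannianManifold (𝓡 m) S] [CompleteSpace S]
    {i : S → M} (hi : IsIsometricImmersion (m := m) (n := n) (N + 2) i) {p : S}
    (hB : ∀ q ∈ Metric.eball p (ENNReal.ofReal ρ),
      formBound (m := m) (n := n) (N + 2) i q ≤ ENNReal.ofReal B)
    {φ : OpenPartialHomeomorph M (Euc n)} (hφ : IsNormalisedChart Γ (N + 2) ρ (i p) φ)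
    {l : ℕ} {P : Euc n →L[ℝ] Euc m} {Q : Euc n →L[ℝ] Euc l}
    (hPQ : ∀ z : Euc n, ‖z‖ ^ 2 = ‖P z‖ ^ 2 + ‖Q z‖ ^ 2)
    (h0 : ∀ v, Q (modelDeriv (m := m) (φ ∘ i) p v) = 0) :
    ∃ ψ : OpenPartialHomeomorph S (Euc m), IsGraphChart (N + 2) i φ ψ P Q ∧
      ψ.target = Metric.ball 0 r ∧ ψ.symm 0 = p ∧
      ∀ x ∈ ψ.target, ∀ j, 2 ≤ j → j ≤ N + 2 →
        ‖iteratedFDeriv ℝ j (φ ∘ i ∘ ψ.symm) x‖ ≤ C := by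
  have hk1 : 1 ≤ N + 2 := by omega
  have hcont : Continuous i := hi.contMDiff.continuous
  have hN : IsOpen (i ⁻¹' φ.source) := φ.open_source.preimage hcont
  have hΦ : ContMDiffOn (𝓡 m) (𝓡 n) ((N + 2 : ℕ) : WithTop ℕ∞) (φ ∘ i) (i ⁻¹' φ.source) :=
    (contMDiffOn_of_mem_maximalAtlas hφ.mem_atlas).comp hi.contMDiff.contMDiffOn fun _ hq' => hq'
  have hpU : p ∈ graphRegion (φ ∘ i) (i ⁻¹' φ.source) P Q := by
    refine ⟨hφ.mem_source, fun v hv => ?_⟩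
    have h1 := (injective_iff_map_eq_zero _).1
      (injective_modelDeriv hi hk1 hφ.mem_atlas hφ.mem_source) v
    have h2 := hPQ (modelDeriv (m := m) (φ ∘ i) p v)
    rw [h0 v, norm_zero] at h2 ⊢
    rw [norm_pos_iff]
    intro h3
    rw [h3, norm_zero] at h2
    exact hv (h1 (norm_eq_zero.1 (by nlinarith [norm_nonneg (modelDeriv (m := m) (φ ∘ i) p v)])))
  -- Every section over a ball of radius at most `r` has the derivative bounds: its points are at
  -- distance less than `2 √Γ r ≤ ρ` from `p`, where the curvature hypothesis applies.
  have hsec : ∀ s, 0 < s → s ≤ r → ∀ α, IsSection (fun q => P ((φ ∘ i) q))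
      (graphRegion (φ ∘ i) (i ⁻¹' φ.source) P Q) p (Metric.ball 0 s) α →
      ∃ ψ : OpenPartialHomeomorph S (Euc m), IsGraphChart (N + 2) i φ ψ P Q ∧
      ψ.target = Metric.ball 0 s ∧ (ψ.symm : Euc m → S) = α ∧
      ∀ x ∈ ψ.target, ∀ j, 2 ≤ j → j ≤ N + 2 →
        ‖iteratedFDeriv ℝ j (φ ∘ i ∘ ψ.symm) x‖ ≤ C := by
    intro s hs hsr α hα
    obtain ⟨ψ, h1, h2, h3, h4⟩ := exists_chart_of_section hk1 hN hΦ Metric.isOpen_ball hα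
    have hψ : IsGraphChart (N + 2) i φ ψ P Q :=
      ⟨h1, h4, fun y hy => by rw [h3]; exact hα.right_inv y (h2 ▸ hy)⟩
    refine ⟨ψ, hψ, h2, h3, fun x hx j hj hj' => ?_⟩
    have h0m : (0 : Euc m) ∈ ψ.target := h2 ▸ Metric.mem_ball_self hs
    have hdist : ψ.symm x ∈ Metric.eball p (ENNReal.ofReal ρ) := by
      have h5 := hψ.edist_symm_le hk1 hΓ hi hφ hPQ (h2 ▸ convex_ball (0 : Euc m) s) hx h0m
      have h6 : ψ.symm 0 = p := by rw [h3]; exact hα.map_zero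
      rw [Metric.mem_eball, ← h6]
      refine h5.trans_lt ?_
      have h7 : ‖x‖ < r := by
        rw [h2] at hx
        exact (mem_ball_zero_iff.1 hx).trans_le hsr
      rw [edist_zero_right, ← ofReal_norm, ← ENNReal.ofReal_mul (by positivity)]
      refine (ENNReal.ofReal_lt_ofReal_iff (by linarith)).2 (lt_of_lt_of_le ?_ hrH)
      gcongr
    obtain ⟨D, hDx, hDF⟩ := hψ.exists_graphGerm hΓ hi hφ hPQ hx (hB _ hdist)
    have := hC D j hj hj'
    rwa [hDx, hDF] at this
  -- The bounds of `hsec` do not depend on the radius, so `exists_tendsto` supplies the boundary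
  -- limits that the continuation requires.
  obtain ⟨α, hα⟩ := (locallyHomeoOn_graphRegion (P := P) (Q := Q) hk1 hN hΦ).exists_section_ball
    hpU (by simp [hφ.map_center]) hr fun s hs hsr α hα z hz => by
      obtain ⟨ψ, h1, h2, h3, h4⟩ := hsec s hs hsr.le α hα
      have h5 : ψ.symm 0 = p := by rw [h3]; exact hα.map_zero
      have := h1.exists_tendsto (by omega) hΓ hi hφ hPQ h2 hs (by linarith)
        (fun y hy => h4 y hy 2 le_rfl (by omega))
        ((mul_le_mul_of_nonneg_left hsr.le hC0).trans hrC) (by rw [h5, hφ.map_center])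
        (by rw [h5]; exact h0) hz
      rwa [h3] at this
  obtain ⟨ψ, h1, h2, h3, h4⟩ := hsec r hr le_rfl α hα
  exact ⟨ψ, h1, h2, by rw [h3]; exact hα.map_zero, h4⟩

end SubmanifoldGraph

end

/-! ### Choice of the constants and assembly -/

theorem lemma4p3 (k m n : ℕ) (hk : 2 ≤ k) (hm : 1 ≤ m) (hmn : m ≤ n)
    (Γ B ρ : ℝ) (hΓ : 0 < Γ) (hB : 0 < B) (hρ : 0 < ρ) :
    ∃ C r : ℝ, 0 < C ∧ 0 < r ∧
      ∀ (M : Type*) [EMetricSpace M] [ChartedSpace (Euc n) M]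
        [IsManifold (𝓡 n) (k : WithTop ℕ∞) M] [IsManifold (𝓡 n) 1 M]
        [RiemannianBundle (fun x : M => TangentSpace (𝓡 n) x)]
        [IsContMDiffRiemannianBundle (𝓡 n) ((k - 1 : ℕ) : WithTop ℕ∞) (Euc n)
          (fun x : M => TangentSpace (𝓡 n) x)]
        [IsRiemannianManifold (𝓡 n) M] [CompleteSpace M]
        (K : Set M) (_ : IsNormalisableAbout (n := n) Γ k ρ K)
        (S : Type*) [EMetricSpace S] [ChartedSpace (Euc m) S]
        [IsManifold (𝓡 m) (k : WithTop ℕ∞) S]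
        [RiemannianBundle (fun x : S => TangentSpace (𝓡 m) x)]
        [IsRiemannianManifold (𝓡 m) S] [CompleteSpace S]
        (i : S → M) (_ : IsIsometricImmersion (m := m) (n := n) k i)
        (p : S) (_ : i p ∈ K)
        (_ : ∀ q ∈ Metric.eball p (ENNReal.ofReal ρ),
          formBound (m := m) (n := n) k i q ≤ ENNReal.ofReal B)
        (φ : OpenPartialHomeomorph M (Euc n)) (_ : IsNormalisedChart Γ k ρ (i p) φ),
        ∃ (f : Euc m → Euc (n - m)) (α : OpenPartialHomeomorph (Euc m) S)
          (A : Euc n ≃ₗᵢ[ℝ] Euc n),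
          ContDiffOn ℝ (k : WithTop ℕ∞) f (Metric.ball 0 r) ∧
          f 0 = 0 ∧ fderiv ℝ f 0 = 0 ∧
          α.source = Metric.ball 0 r ∧ α 0 = p ∧
          ContMDiffOn (𝓡 m) (𝓡 m) (k : WithTop ℕ∞) α α.source ∧
          ContMDiffOn (𝓡 m) (𝓡 m) (k : WithTop ℕ∞) α.symm α.target ∧
          LinearMap.det (A.toLinearEquiv : Euc n →ₗ[ℝ] Euc n) = 1 ∧
          (∀ x ∈ Metric.ball (0 : Euc m) r,
            i (α x) ∈ φ.source ∧ φ (i (α x)) = A (joinCoords x (f x))) ∧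
          ckNorm k f (Metric.ball 0 r) ≤ ENNReal.ofReal C := by
  obtain ⟨N, rfl⟩ : ∃ N, k = N + 2 := ⟨k - 2, by omega⟩
  obtain ⟨C₀, hC₀, hC⟩ := GraphGerm.exists_norm_iteratedFDeriv_le m n N hΓ hB.le
  have hsΓ : 0 < √Γ := Real.sqrt_pos.2 hΓ
  -- The three entries keep the graph in the ball of the chart, its points in `B_ρ(p)`, and its
  -- slope at most `1 / 2`.
  set r := min (ρ / 2) (min (ρ / (2 * √Γ)) (1 / 2 / C₀)) with hr
  have hr0 : 0 < r := by positivity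
  have hrρ : 2 * r ≤ ρ := by
    have : r ≤ ρ / 2 := min_le_left _ _
    linarith
  have hrH : 2 * √Γ * r ≤ ρ := by
    have : r ≤ ρ / (2 * √Γ) := (min_le_right _ _).trans (min_le_left _ _)
    rw [le_div_iff₀ (by positivity)] at this
    linarith
  have hrC : C₀ * r ≤ 1 / 2 := by
    have : r ≤ 1 / 2 / C₀ := (min_le_right _ _).trans (min_le_right _ _)
    rw [le_div_iff₀ hC₀] at this
    linarith
  -- There are `k + 1` orders, each bounded by `ρ + 2 + C₀`: `ρ` serves for the value, as `‖F x‖ ≤ 2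
  -- r`, then `2` for the first derivative and `C₀` for the others.
  refine ⟨((N + 2 : ℕ) + 1) * (ρ + 2 + C₀), r, by positivity, hr0, ?_⟩
  intro M _ _ hMk _ _ hMR _ _ K _ S _ _ _ _ _ _ i hi p _ hform φ hφ
  have hMR' : IsContMDiffRiemannianBundle (𝓡 n) ((N + 1 : ℕ) : WithTop ℕ∞) (Euc n)
    (fun x : M => TangentSpace (𝓡 n) x) := hMR
  have hk1 : 1 ≤ N + 2 := by omega
  obtain ⟨A, hdet, hA⟩ := exists_rotation_adapted hm hmn
    (modelDeriv (m := m) (φ ∘ i) p).toLinearMap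
    (injective_modelDeriv hi hk1 hφ.mem_atlas hφ.mem_source)
  let P : Euc n →L[ℝ] Euc m :=
    (headCoords hmn).comp (A.symm.toContinuousLinearEquiv : Euc n →L[ℝ] Euc n)
  let Q : Euc n →L[ℝ] Euc (n - m) :=
    (tailCoords m n).comp (A.symm.toContinuousLinearEquiv : Euc n →L[ℝ] Euc n)
  have hPQ : ∀ z : Euc n, ‖z‖ ^ 2 = ‖P z‖ ^ 2 + ‖Q z‖ ^ 2 := fun z => by
    rw [← A.symm.norm_map z]
    exact norm_sq_eq_head_add_tail hmn (A.symm z)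
  have hQle : ‖Q‖ ≤ 1 := by
    refine ContinuousLinearMap.opNorm_le_bound _ zero_le_one fun z => ?_
    rw [one_mul]
    refine (abs_le_of_sq_le_sq' ?_ (norm_nonneg z)).2
    rw [hPQ z]
    nlinarith [sq_nonneg ‖P z‖]
  have h0 : ∀ v, Q (modelDeriv (m := m) (φ ∘ i) p v) = 0 := hA
  obtain ⟨ψ, hψ, hψt, hψ0, hψC⟩ := exists_isGraphChart_ball hΓ hr0 hrρ hrH hrC hC₀.le hC hi hform hφ
    hPQ h0
  set F := φ ∘ i ∘ ψ.symm with hF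
  have hFd : ∀ x ∈ Metric.ball (0 : Euc m) r, ContDiffAt ℝ (N + 2 : ℕ) F x := fun x hx =>
    hψ.contDiffAt hi.contMDiff hφ.mem_atlas (hψt ▸ hx)
  have hF0 : F 0 = 0 := by simp [hF, hψ0, hφ.map_center]
  have h0m : (0 : Euc m) ∈ ψ.target := hψt ▸ Metric.mem_ball_self hr0
  have hk0 : ((N + 2 : ℕ) : WithTop ℕ∞) ≠ 0 := by exact_mod_cast (by omega : N + 2 ≠ 0)
  refine ⟨fun x => Q (F x), ψ.symm, A, fun x hx => (Q.contDiff.contDiffAt.comp x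
    (hFd x hx)).contDiffWithinAt, by simp [hF0], ?_, hψt, hψ0,
    contMDiffOn_symm_of_mem_maximalAtlas hψ.mem_atlas,
    contMDiffOn_of_mem_maximalAtlas hψ.mem_atlas, hdet, fun x hx => ?_, ?_⟩
  · have h1 : HasFDerivAt (fun x => Q (F x)) (Q.comp (fderiv ℝ F 0)) 0 :=
      Q.hasFDerivAt.comp 0 ((hFd 0 (Metric.mem_ball_self hr0)).differentiableAt hk0).hasFDerivAt
    rw [h1.fderiv]
    ext1 v
    rw [ContinuousLinearMap.comp_apply, hψ.fderiv_eq hk1 hi.contMDiff hφ.mem_atlas h0m, hψ0]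
    exact h0 _
  · have hx' : x ∈ ψ.target := hψt ▸ hx
    refine ⟨hψ.mem_source hx', ?_⟩
    have h1 : P (F x) = x := hψ.apply_symm x hx'
    have h2 := joinCoords_head_tail hmn (A.symm (F x))
    -- Since `P (F x) = x`, the pair `(x, f x)` consists of the head and tail of `A⁻¹ (F x)`.
    have h3 : joinCoords x (Q (F x)) = A.symm (F x) := by
      have h4 : joinCoords (P (F x)) (Q (F x)) = A.symm (F x) := h2
      rwa [h1] at h4
    rw [h3, A.apply_symm_apply]
    rfl
  · refine ckNorm_le_of_forall fun j hj x hx => ?_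
    have hx' : x ∈ ψ.target := hψt ▸ hx
    have h1 : ‖iteratedFDeriv ℝ j (fun x => Q (F x)) x‖ ≤ ‖Q‖ * ‖iteratedFDeriv ℝ j F x‖ :=
      Q.norm_iteratedFDeriv_comp_left (hFd x hx) (by exact_mod_cast hj)
    have h2 : ‖iteratedFDeriv ℝ j F x‖ ≤ ρ + 2 + C₀ := by
      rcases lt_or_ge j 2 with h | h
      · interval_cases j
        · have h3 := hψ.norm_apply_le hk1 hi.contMDiff hφ.mem_atlas hPQ hψt
            (by rw [hψ0, hφ.map_center]) hx'
          have h4 : ‖x‖ < r := mem_ball_zero_iff.1 hx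
          rw [norm_iteratedFDeriv_zero]
          refine h3.trans ?_
          linarith
        · rw [norm_iteratedFDeriv_one]
          exact (hψ.norm_fderiv_le hk1 hi.contMDiff hφ.mem_atlas hPQ hx').trans (by linarith)
      · exact (hψC x hx' j h hj).trans (by linarith)
    calc _ ≤ ‖Q‖ * ‖iteratedFDeriv ℝ j F x‖ := h1
      _ ≤ 1 * (ρ + 2 + C₀) := by gcongr
      _ = _ := one_mul _
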